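/- Let $C$ be an algebraically closed field of characteristic zero, let $R$ be a complete discrete valuation ring which is a $C$-algebra isomorphic to $C[[t]]$, with maximal ideal $\mathfrak r$ and fraction field $K$. For a ring $A\in\{R,K\}$ put $A((x))=A[[x]][x^{-1}]$ and $\vartheta=x\,\frac{d}{dx}$. A connection over $A((x))$ is a finite $A((x))$-module $E$ with an $A$-linear map $\nabla:E\to E$ such that $\nabla(fe)=\vartheta(f)e+f\nabla(e)$. Call $f\in A((x))$ a representative of $\varphi\in A[x^{-1}]/\mathbb Z$ if $f-g\in \mathbb Z+xA[[x]]$ for some $g\in A[x^{-1}]$ with class $\varphi$. A TLJ-decomposition of $(E,\nabla)$ over $A((x))$ is a decomposition $E=\bigoplus_{\varphi\in\Phi}E_\varphi$, with $\Phi\subset A[x^{-1}]/\mathbb Z$ finite, into nonzero $\nabla$-stable submodules such that $E_\varphi$ is generated over $A((x))$ by $\ker(\nabla-f_\varphi)^{q}$ for some representative $f_\varphi$ of $\varphi$ and all sufficiently large $q$. A TLJ-form over $A((x))$ is such a decomposition in which every $E_\varphi$ has an $A((x))$-basis in which the matrix of $\nabla$ has a representative of $\varphi$ in all its diagonal entries,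 entries in $\{0,1\}$ just below the diagonal, and zeros elsewhere. Let $(E,\nabla)$ be a connection over $R((x))$ without $R$-torsion, of rank $n$. Suppose that it has $n$ distinct characters $\varphi_1,\dots,\varphi_n\in R[x^{-1}]/\mathbb Z$, that is, the image of each $\varphi_i$ in $K[x^{-1}]/\mathbb Z$ belongs to the index set $\Phi$ of a TLJ-decomposition over $K((x))$ of $K((x))\otimes_{R((x))}E$ with its induced connection. Suppose that $(E,\nabla)$ has no turning point at $\mathfrak r$: there are representatives $h_i\in R[x^{-1}]$ of the $\varphi_i$ such that every $h_i$ is invertible in $R((x))$ and, for all $i\neq j$ and all $m\in\mathbb Z$, $h_i-h_j+m$ is invertible in $R((x))$. Then $(E,\nabla)$ admits a TLJ-form over $R((x))$. Moreover, for all representatives $f_1,\dots,f_n\in R[x^{-1}]$ of $\varphi_1,\dots,\varphi_n$ there is an $R((x))$-basis of $E$ in which the matrix of $\nabla$ is $\mathrm{diag}(f_1,\dots,f_n)$. -/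

import Mathlib

open scoped LaurentSeries PowerSeries TensorProduct

noncomputable section

namespace RelConn

section Laurent

variable (A : Type*) [CommRing A]

/-- The derivation `ϑ = x d/dx` of `A((x))`, sending `∑ aₙ xⁿ` to `∑ n aₙ xⁿ`. -/
def euler : A⸨X⸩ →+ A⸨X⸩ where
  toFun f :=
    { coeff := fun n => (n : A) * f.coeff n
      isPWO_support' := f.isPWO_support.mono fun n hn h0 => hn (by simp [h0]) }
  map_zero' := by ext n; simp
  map_add' f g := by ext n; simp [mul_add]

variable {A}

@[simp] theorem euler_coeff (f : A⸨X⸩) (n : ℤ) :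
    (euler A f).coeff n = (n : A) * f.coeff n := rfl

theorem support_euler_subset (f : A⸨X⸩) : (euler A f).support ⊆ f.support :=
  fun n hn h0 => hn (by simp [h0])

theorem euler_mul (f g : A⸨X⸩) : euler A (f * g) = euler A f * g + f * euler A g := by
  ext n
  rw [HahnSeries.coeff_add, euler_coeff, HahnSeries.coeff_mul,
    HahnSeries.coeff_mul_left' f.isPWO_support (support_euler_subset f),
    HahnSeries.coeff_mul_right' g.isPWO_support (support_euler_subset g),
    Finset.mul_sum, ← Finset.sum_add_distrib]
  refine Finset.sum_congr rfl fun ij hij => ?_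
  have h : ij.1 + ij.2 = n := (Finset.mem_antidiagonal.mp hij).2.2
  rw [euler_coeff, euler_coeff, ← h]
  push_cast
  ring

variable (A)

/-- `A[x⁻¹]`, as the group of Laurent series without terms of positive degree. -/
def invPoly : AddSubgroup A⸨X⸩ where
  carrier := {f | ∀ k : ℤ, 0 < k → f.coeff k = 0}
  zero_mem' := fun k _ => by simp
  add_mem' := fun {f g} hf hg k hk => by simp [hf k hk, hg k hk]
  neg_mem' := fun {f} hf k hk => by simp [hf k hk]

/-- The integers, as a subgroup of `A((x))`. -/
def intConst : AddSubgroup A⸨X⸩ := (Int.castAddHom A⸨X⸩).range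

/-- The group `A[x⁻¹]/ℤ` in which characters live. -/
abbrev CharGroup : Type _ := invPoly A ⧸ (intConst A).addSubgroupOf (invPoly A)

/-- `dLog`: the power series whose constant term is an integer. -/
def dLog : AddSubgroup A⸨X⸩ where
  carrier := {f | (∀ k : ℤ, k < 0 → f.coeff k = 0) ∧ ∃ m : ℤ, f.coeff 0 = (m : A)}
  zero_mem' := ⟨fun k _ => by simp, 0, by simp⟩
  add_mem' := by
    rintro f g ⟨hf, m, hm⟩ ⟨hg, l, hl⟩
    exact ⟨fun k hk => by simp [hf k hk, hg k hk], m + l, by simp [hm, hl]⟩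
  neg_mem' := by
    rintro f ⟨hf, m, hm⟩
    exact ⟨fun k hk => by simp [hf k hk], -m, by simp [hm]⟩

variable {A}

/-- The class in `A[x⁻¹]/ℤ` of an element of `A[x⁻¹]`. -/
def charClass (f : invPoly A) : CharGroup A := QuotientAddGroup.mk f

/-- `f ∈ A((x))` represents `φ ∈ A[x⁻¹]/ℤ` (which is `A((x))/dLog`). -/
def Represents (f : A⸨X⸩) (φ : CharGroup A) : Prop :=
  ∃ g : invPoly A, charClass g = φ ∧ f - (g : A⸨X⸩) ∈ dLog A

end Laurent

section Connection

variable (A : Type*) [CommRing A] (E : Type*) [AddCommGroup E] [Module A⸨X⸩ E]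

/-- A connection on the `A((x))`-module `E`: an additive map with Leibniz's rule for `ϑ`.
It is `A`-linear by `Connection.map_C_smul` below. -/
structure Connection where
  nabla : E →+ E
  leibniz : ∀ (f : A⸨X⸩) (e : E), nabla (f • e) = euler A f • e + f • nabla e

/-- `E` has no torsion over the ring of constants `A`. -/
def NoConstTorsion : Prop :=
  ∀ a : A, a ≠ 0 → ∀ e : E, (HahnSeries.C a : A⸨X⸩) • e = 0 → e = 0

variable {A E}

namespace Connection

theorem map_C_smul (D : Connection A E) (a : A) (e : E) :
    D.nabla ((HahnSeries.C a : A⸨X⸩) • e) = (HahnSeries.C a : A⸨X⸩) • D.nabla e := by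
  have h : euler A (HahnSeries.C a) = 0 := by
    ext n
    by_cases hn : n = 0
    · simp [hn]
    · simp [HahnSeries.C_apply, HahnSeries.coeff_single_of_ne hn]
  rw [D.leibniz, h, zero_smul, zero_add]

/-- The operator `∇ - f` on `E`. -/
def shift (D : Connection A E) (f : A⸨X⸩) (e : E) : E := D.nabla e - f • e

/-- The `A((x))`-submodule of `E` generated by `ker (∇ - f)^q`. -/
def kerSpan (D : Connection A E) (f : A⸨X⸩) (q : ℕ) : Submodule A⸨X⸩ E :=
  Submodule.span A⸨X⸩ {e | (D.shift f)^[q] e = 0}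

/-- `E = ⨁_{φ ∈ Φ} F φ` is a Turrittin-Levelt-Jordan decomposition over `A((x))`: the set
`Φ ⊆ A[x⁻¹]/ℤ` is finite, and for `φ ∈ Φ` the component `F φ` is a nonzero subconnection,
generated by `ker (∇ - f)^q` for a representative `f` of `φ` and all large `q`. -/
structure IsTLJDecomposition (D : Connection A E) (Φ : Set (CharGroup A))
    (F : CharGroup A → Submodule A⸨X⸩ E) : Prop where
  finite : Φ.Finite
  indep : iSupIndep fun φ : Φ => F φ
  span : ⨆ φ : Φ, F φ = ⊤
  ne_bot : ∀ φ ∈ Φ, F φ ≠ ⊥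
  stable : ∀ φ ∈ Φ, ∀ e ∈ F φ, D.nabla e ∈ F φ
  eq_kerSpan : ∀ φ ∈ Φ, ∃ f : A⸨X⸩, Represents f φ ∧ ∃ q₀ : ℕ, ∀ q ≥ q₀, F φ = D.kerSpan f q

/-- The matrix `M` has the shape `J♭(f)`: `f` on the diagonal, entries `0` or `1` just below
the diagonal, and `0` elsewhere. -/
def IsJFlat {r : ℕ} (f : A⸨X⸩) (M : Matrix (Fin r) (Fin r) A⸨X⸩) : Prop :=
  ∀ i j : Fin r,
    (i = j → M i j = f) ∧
    ((i : ℕ) = j + 1 → M i j = 0 ∨ M i j = 1) ∧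
    (i ≠ j → (i : ℕ) ≠ j + 1 → M i j = 0)

/-- `(E, ∇)` admits a Turrittin-Levelt-Jordan form over `A((x))`: it has a TLJ-decomposition
in which every component `F φ` has a basis with `Mat(∇) = J♭(f)`, `f` a representative of `φ`. -/
def AdmitsTLJForm (D : Connection A E) : Prop :=
  ∃ (Φ : Set (CharGroup A)) (F : CharGroup A → Submodule A⸨X⸩ E),
    D.IsTLJDecomposition Φ F ∧
    ∀ φ ∈ Φ, ∃ f : A⸨X⸩, Represents f φ ∧
      ∃ (r : ℕ) (b : Module.Basis (Fin r) A⸨X⸩ (F φ)) (M : Matrix (Fin r) (Fin r) A⸨X⸩),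
        IsJFlat f M ∧ ∀ j, D.nabla (b j : E) = ∑ i, M i j • (b i : E)

end Connection

end Connection

section BaseChange

variable (R : Type*) [CommRing R]

/-- The inclusion `R((x)) → K((x))`, where `K` is the fraction field of `R`. -/
def laurentMap : R⸨X⸩ →+* (FractionRing R)⸨X⸩ where
  toFun f := f.map (algebraMap R (FractionRing R))
  map_zero' := by ext n; simp
  map_one' := HahnSeries.map_one (algebraMap R (FractionRing R)).toMonoidWithZeroHom
  map_add' f g := by ext n; simp
  map_mul' f g :=
    HahnSeries.map_mul (algebraMap R (FractionRing R)).toNonUnitalRingHom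

instance : Algebra R⸨X⸩ (FractionRing R)⸨X⸩ := (laurentMap R).toAlgebra

variable {R}

theorem laurentMap_coeff (f : R⸨X⸩) (n : ℤ) :
    (laurentMap R f).coeff n = algebraMap R (FractionRing R) (f.coeff n) := rfl

theorem euler_laurentMap (f : R⸨X⸩) :
    euler (FractionRing R) (laurentMap R f) = laurentMap R (euler R f) := by
  ext n
  simp [laurentMap_coeff]

theorem smul_eq_laurentMap_mul (f : R⸨X⸩) (g : (FractionRing R)⸨X⸩) :
    f • g = laurentMap R f * g := Algebra.smul_def f g

/-- The natural map `R[x⁻¹]/ℤ → K[x⁻¹]/ℤ`. -/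
def charMap : CharGroup R →+ CharGroup (FractionRing R) :=
  QuotientAddGroup.map _ _
    (((laurentMap R).toAddMonoidHom.comp (invPoly R).subtype).codRestrict
      (invPoly (FractionRing R)) (fun f k hk => by
        change (laurentMap R (f : R⸨X⸩)).coeff k = 0
        rw [laurentMap_coeff, f.2 k hk, map_zero]))
    (by
      rintro f ⟨m, hm⟩
      refine ⟨m, ?_⟩
      change _ = laurentMap R (f : R⸨X⸩)
      have hm' : ((m : ℤ) : R⸨X⸩) = (f : R⸨X⸩) := hm
      rw [← hm', map_intCast]
      rfl)

variable {E : Type*} [AddCommGroup E] [Module R⸨X⸩ E]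

namespace Connection

/-- `(E_{K((x))}, ∇)`, with `∇ (g ⊗ e) = ϑ(g) ⊗ e + g ⊗ ∇ e`. -/
def baseChange (D : Connection R E) :
    Connection (FractionRing R) ((FractionRing R)⸨X⸩ ⊗[R⸨X⸩] E) where
  nabla := TensorProduct.liftAddHom
    (AddMonoidHom.mk' (fun g => AddMonoidHom.mk'
        (fun e => euler (FractionRing R) g ⊗ₜ[R⸨X⸩] e + g ⊗ₜ[R⸨X⸩] D.nabla e)
        (fun e e' => by simp only [TensorProduct.tmul_add, map_add]; abel))
      (fun g g' => by
        ext e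
        simp only [AddMonoidHom.mk'_apply, AddMonoidHom.add_apply, TensorProduct.add_tmul,
          map_add]
        abel))
    (fun f g e => by
      simp only [AddMonoidHom.mk'_apply]
      rw [D.leibniz, smul_eq_laurentMap_mul, euler_mul, euler_laurentMap,
        ← smul_eq_laurentMap_mul, ← smul_eq_laurentMap_mul, TensorProduct.add_tmul,
        TensorProduct.tmul_add, ← TensorProduct.smul_tmul (euler R f) g e,
        ← TensorProduct.smul_tmul f g (D.nabla e), ← TensorProduct.smul_tmul f _ e]
      abel)
  leibniz f z := by
    induction z using TensorProduct.induction_on with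
    | zero => simp
    | tmul g e =>
      simp only [TensorProduct.smul_tmul', TensorProduct.liftAddHom_tmul,
        AddMonoidHom.mk'_apply, smul_eq_mul, smul_add, euler_mul, TensorProduct.add_tmul]
      abel
    | add y z hy hz =>
      simp only [smul_add, map_add, hy, hz]
      abel

theorem baseChange_tmul (D : Connection R E) (g : (FractionRing R)⸨X⸩) (e : E) :
    D.baseChange.nabla (g ⊗ₜ[R⸨X⸩] e) =
      euler (FractionRing R) g ⊗ₜ[R⸨X⸩] e + g ⊗ₜ[R⸨X⸩] D.nabla e := rfl

/-- `φ ∈ R[x⁻¹]/ℤ` is a character of `(E, ∇)`: it is one of the characters in a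
TLJ-decomposition of `(E_{K((x))}, ∇)` over `K((x))`. -/
def HasCharacter (D : Connection R E) (φ : CharGroup R) : Prop :=
  ∃ (Φ : Set (CharGroup (FractionRing R)))
    (F : CharGroup (FractionRing R) →
      Submodule (FractionRing R)⸨X⸩ ((FractionRing R)⸨X⸩ ⊗[R⸨X⸩] E)),
    D.baseChange.IsTLJDecomposition Φ F ∧ charMap φ ∈ Φ

end Connection

/-- No turning point, for a connection whose distinct characters are the `φ i`: there are
representatives `f i ∈ R[x⁻¹]` of the `φ i` which are invertible in `R((x))` and whose
differences `f i - f j`, `i ≠ j`, are invertible in `R((x))`. As the characters are classes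
modulo `ℤ`, the latter is required of every representative of the class `φ i - φ j`. -/
def NoTurningPoint {ι : Type*} (φ : ι → CharGroup R) : Prop :=
  ∃ f : ι → invPoly R,
    (∀ i, charClass (f i) = φ i) ∧
    (∀ i, IsUnit (f i : R⸨X⸩)) ∧
    ∀ i j, i ≠ j → ∀ m : ℤ, IsUnit ((f i : R⸨X⸩) - (f j : R⸨X⸩) + (m : R⸨X⸩))

end BaseChange

end RelConn

end

/-! Over `K((x))`, a nonzero vector of `ker (∇ - f)^q` yields an eigenvector of `∇`, and rescaling
it by a solution of `ϑ z = (h_i - f) z` gives `e_i` with `∇ e_i = h_i e_i`. The `e_i` are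
independent because an element of `K[x⁻¹]` that is a logarithmic derivative is an integer, so they
form a basis for rank reasons.

The point is the descent to `R((x))`. Elements of `K((x))` may have unbounded denominators, so the
`e_i` cannot simply be scaled into `E`. Instead `E` is viewed, through coordinates in the `e_i`, as
an `R((x))`-submodule `W` of `K((x))ⁿ`, stable under `ϑ + diag(h)`. The map is injective: the
annihilator of its kernel is a nonzero `ϑ`-stable ideal, so it contains a nonzero constant
(`injective_of_noConstTorsion`). By Krull's intersection theorem, `W` is `x`-adically closed.

The operator `x^s (∇ - h_i)` acts on the graded pieces of each component where `h_j - h_i` has a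
pole of order at most `s` by scalars of `R`. Absence of turning points makes those with pole order
exactly `s` differ by units from those of component `i`. Bézout identities in `R[X]` then give
polynomials in the operator approximating the projection to component `i`, and closedness puts the
projection in `W` (`exists_mem_kill_step`, `single_mem_of_mem`). The same method applied to `ϑ`
isolates single coefficients (`single_C_coeff_mem`). So `W` is governed by the `R`-modules of
constants `a` with `a e_i ∈ W`. These are nonzero fractional ideals, hence principal, and their
generators give the basis (`exists_basis_of_embedding`). -/

noncomputable section
namespace RelConn

/-! ### The filtration of `A((x))` by order -/

section Order
variable {A : Type*} [CommRing A]

/-- The additive group `x ^ k A⟦x⟧` of Laurent series of order at least `k`. -/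
def ordGE (A : Type*) [CommRing A] (k : ℤ) : AddSubgroup A⸨X⸩ where
  carrier := {f | ∀ l < k, f.coeff l = 0}
  zero_mem' := fun l _ => by simp
  add_mem' := fun {f g} hf hg l hl => by simp [hf l hl, hg l hl]
  neg_mem' := fun {f} hf l hl => by simp [hf l hl]

theorem ordGE_anti {k l : ℤ} (h : k ≤ l) : ordGE A l ≤ ordGE A k :=
  fun _ hf m hm => hf m (hm.trans_le h)

theorem exists_mem_ordGE (f : A⸨X⸩) : ∃ k : ℤ, f ∈ ordGE A k := by
  by_cases h : f = 0
  · exact ⟨0, h ▸ zero_mem _⟩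
  · exact ⟨f.order, fun l hl => HahnSeries.coeff_eq_zero_of_lt_order hl⟩

theorem exists_nat_forall_mem_ordGE {ι : Type*} [Finite ι] (v : ι → A⸨X⸩) :
    ∃ N : ℕ, ∀ i, v i ∈ ordGE A (-N) := by
  cases nonempty_fintype ι
  choose k hk using fun i => exists_mem_ordGE (v i)
  refine ⟨∑ i, (k i).natAbs, fun i => ordGE_anti ?_ (hk i)⟩
  have := Finset.single_le_sum (f := fun i => (k i).natAbs) (fun _ _ => Nat.zero_le _)
    (Finset.mem_univ i)
  have h2 : (((k i).natAbs : ℕ) : ℤ) ≤ ((∑ i, (k i).natAbs : ℕ) : ℤ) := by exact_mod_cast this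
  omega

theorem mul_mem_ordGE {k l : ℤ} {f g : A⸨X⸩} (hf : f ∈ ordGE A k) (hg : g ∈ ordGE A l) :
    f * g ∈ ordGE A (k + l) := by
  intro m hm
  rw [HahnSeries.coeff_mul]
  refine Finset.sum_eq_zero fun ij hij => ?_
  have h : ij.1 + ij.2 = m := (Finset.mem_antidiagonal.mp hij).2.2
  rcases lt_or_ge ij.1 k with h1 | h1
  · rw [hf _ h1, zero_mul]
  · rw [hg _ (by omega), mul_zero]

theorem coeff_mul_of_mem_ordGE {k l : ℤ} {f g : A⸨X⸩} (hf : f ∈ ordGE A k) (hg : g ∈ ordGE A l) :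
    (f * g).coeff (k + l) = f.coeff k * g.coeff l := by
  rw [HahnSeries.coeff_mul]
  rw [Finset.sum_eq_single (k, l)]
  · rintro ⟨a, b⟩ hij hne
    have h : a + b = k + l := (Finset.mem_antidiagonal.mp hij).2.2
    rcases lt_trichotomy a k with h1 | h1 | h1
    · rw [hf _ h1, zero_mul]
    · exact absurd (Prod.ext h1 (by simp; omega)) hne
    · rw [hg b (by omega), mul_zero]
  · intro hn
    by_contra h
    refine hn (Finset.mem_antidiagonal.mpr ⟨?_, ?_, rfl⟩)
    · exact fun h0 => h (by simp [h0])
    · exact fun h0 => h (by simp [h0])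

theorem single_mem_ordGE (k : ℤ) (a : A) : (HahnSeries.single k a : A⸨X⸩) ∈ ordGE A k :=
  fun _ hl => HahnSeries.coeff_single_of_ne hl.ne

theorem coeff_single_mul' (k l : ℤ) (a : A) (f : A⸨X⸩) :
    (HahnSeries.single k a * f).coeff l = a * f.coeff (l - k) := by
  have := HahnSeries.coeff_single_mul_add (r := a) (x := f) (a := l - k) (b := k)
  rwa [sub_add_cancel] at this

theorem coeff_C_mul' (l : ℤ) (a : A) (f : A⸨X⸩) :
    (HahnSeries.C a * f).coeff l = a * f.coeff l := by
  rw [HahnSeries.C_apply, coeff_single_mul', sub_zero]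

theorem C_mem_ordGE (a : A) : (HahnSeries.C a : A⸨X⸩) ∈ ordGE A 0 := single_mem_ordGE 0 a

theorem euler_single (k : ℤ) (a : A) :
    euler A (HahnSeries.single k a) = (k : A⸨X⸩) * HahnSeries.single k a := by
  ext l
  have : ((k : ℤ) : A⸨X⸩) = HahnSeries.C (k : A) := by simp
  rw [this, coeff_C_mul', euler_coeff]
  by_cases h : l = k
  · rw [h]
  · simp [HahnSeries.coeff_single_of_ne h]

theorem single_mul_single_neg (k : ℤ) :
    (HahnSeries.single k 1 : A⸨X⸩) * HahnSeries.single (-k) 1 = 1 := by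
  rw [HahnSeries.single_mul_single, add_neg_cancel, mul_one]; rfl

theorem isUnit_single (k : ℤ) : IsUnit (HahnSeries.single k 1 : A⸨X⸩) :=
  IsUnit.of_mul_eq_one _ (single_mul_single_neg k)

theorem euler_C (a : A) : euler A (HahnSeries.C a) = 0 := by
  rw [HahnSeries.C_apply, euler_single]; simp

end Order

/-! ### Leading coefficients over a domain -/

section Domain
variable {A : Type*} [CommRing A] [IsDomain A]

/-- The lowest coefficient of a Laurent series which is invertible is invertible. -/
theorem isUnit_coeff_order {f : A⸨X⸩} (hf : IsUnit f) : IsUnit (f.coeff f.order) := by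
  obtain ⟨g, hg⟩ := hf.exists_right_inv
  have hf' : f ∈ ordGE A f.order := fun l hl => HahnSeries.coeff_eq_zero_of_lt_order hl
  have hg' : g ∈ ordGE A g.order := fun l hl => HahnSeries.coeff_eq_zero_of_lt_order hl
  have hf0 : f ≠ 0 := hf.ne_zero
  have hg0 : g ≠ 0 := fun h => by simp [h] at hg
  have h1 := coeff_mul_of_mem_ordGE hf' hg'
  have h2 : f.order + g.order = 0 := by
    rw [← HahnSeries.order_mul hf0 hg0, hg, HahnSeries.order_one]
  rw [hg, h2] at h1
  exact IsUnit.of_mul_eq_one _ (h1.symm.trans (by simp))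

/-- An element of `A[x⁻¹]` which is a logarithmic derivative is an integer. -/
theorem mem_intConst_of_euler_eq_mul {g w : A⸨X⸩} (hg : g ∈ invPoly A) (hw : w ≠ 0)
    (h : euler A w = g * w) : g ∈ intConst A := by
  have hw' : w ∈ ordGE A w.order := fun l hl => HahnSeries.coeff_eq_zero_of_lt_order hl
  have hg' : g ∈ ordGE A g.order := fun l hl => HahnSeries.coeff_eq_zero_of_lt_order hl
  have hw0 : w.coeff w.order ≠ 0 := HahnSeries.coeff_order_eq_zero.not.mpr hw
  by_cases hg0 : g = 0
  · exact hg0 ▸ zero_mem _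
  have hgc : g.coeff g.order ≠ 0 := HahnSeries.coeff_order_eq_zero.not.mpr hg0
  have h1 := coeff_mul_of_mem_ordGE hg' hw'
  rw [← h, euler_coeff] at h1
  have hle : g.order ≤ 0 := not_lt.mp fun hlt => hgc (hg _ hlt)
  have hge : g.order = 0 := by
    -- A pole of `g` would give `g w` a nonzero coefficient below the order of `w`, where `ϑ w` has
    -- none.
    by_contra hne
    rw [hw' (g.order + w.order) (by omega), mul_zero] at h1
    exact mul_ne_zero hgc hw0 h1.symm
  rw [hge, zero_add] at h1
  have h2 := mul_right_cancel₀ hw0 h1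
  refine ⟨w.order, ?_⟩
  ext l
  change ((w.order : ℤ) : A⸨X⸩).coeff l = _
  have : ((w.order : ℤ) : A⸨X⸩) = HahnSeries.C (w.order : A) := by simp
  rw [this, HahnSeries.C_apply]
  rcases lt_trichotomy l 0 with hl | hl | hl
  · rw [HahnSeries.coeff_single_of_ne hl.ne, hg' l (by omega)]
  · rw [hl, HahnSeries.coeff_single_same, h2]
  · rw [HahnSeries.coeff_single_of_ne hl.ne', hg l hl]

end Domain

/-! ### Solving `ϑ z = s z` -/

section LogDeriv
variable {K : Type*} [Field K] [CharZero K]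

/-- Coefficients of the solution with constant term `1` of `ϑ z = s z`, where `s` is a power
series without constant term. -/
def expCoeff (s : ℕ → K) : ℕ → K
  | 0 => 1
  | k + 1 => (∑ l : Fin (k + 1), s (k + 1 - l) * expCoeff s l) / ((k + 1 : ℕ) : K)

/-- In degree `k` the equation reads `k c_k = ∑_{l<k} s_{k-l} c_l`, since `s` has no constant term;
`expCoeff` is this recursion. -/
theorem exists_euler_eq_mul_of_mem_ordGE {s : K⸨X⸩} (hs : s ∈ ordGE K 1) :
    ∃ z : K⸨X⸩, z ≠ 0 ∧ euler K z = s * z := by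
  set c : ℕ → K := expCoeff fun k => s.coeff k with hc
  set p : K⟦X⟧ := PowerSeries.mk c
  set q : K⟦X⟧ := PowerSeries.mk fun k => s.coeff k with hq
  have hsq : s = (q : K⸨X⸩) := by
    ext l
    rcases lt_or_ge l 0 with hl | hl
    · rw [hs l (by omega), PowerSeries.coeff_coe, if_pos hl]
    · obtain ⟨m, rfl⟩ := Int.eq_ofNat_of_zero_le hl
      rw [LaurentSeries.coeff_coe_powerSeries, hq, PowerSeries.coeff_mk]
  refine ⟨(p : K⸨X⸩), fun h => ?_, ?_⟩
  · have := congrArg (fun f : K⸨X⸩ => f.coeff ((0 : ℕ) : ℤ)) h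
    simp only [LaurentSeries.coeff_coe_powerSeries] at this
    simp [p, hc, expCoeff] at this
  · rw [hsq, ← PowerSeries.coe_mul]
    ext l
    rw [euler_coeff]
    rcases lt_or_ge l 0 with hl | hl
    · rw [PowerSeries.coeff_coe, PowerSeries.coeff_coe, if_pos hl, if_pos hl, mul_zero]
    · obtain ⟨m, rfl⟩ := Int.eq_ofNat_of_zero_le hl
      rw [LaurentSeries.coeff_coe_powerSeries, LaurentSeries.coeff_coe_powerSeries, mul_comm q p,
        PowerSeries.coeff_mul, Finset.Nat.sum_antidiagonal_eq_sum_range_succ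
          (fun i j => p.coeff i * q.coeff j), Finset.sum_range_succ]
      have h0 : q.coeff 0 = 0 := by rw [hq, PowerSeries.coeff_mk]; exact hs _ (by simp)
      rw [Nat.sub_self, h0, mul_zero, add_zero]
      cases m with
      | zero => simp
      | succ k =>
        have hk : ((k + 1 : ℕ) : K) ≠ 0 := Nat.cast_ne_zero.mpr k.succ_ne_zero
        have h1 : c (k + 1) * ((k + 1 : ℕ) : K)
            = ∑ l : Fin (k + 1), s.coeff ((k + 1 - l : ℕ) : ℤ) * c l := by
          rw [hc, expCoeff, div_mul_cancel₀ _ hk]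
        simp only [p, hq, PowerSeries.coeff_mk]
        rw [Finset.sum_range, Int.cast_natCast, mul_comm, h1]
        exact Finset.sum_congr rfl fun i _ => mul_comm _ _

/-- The integer constant term `m` is absorbed by a factor `x ^ m`. -/
theorem exists_euler_eq_mul_of_mem_dLog {s : K⸨X⸩} (hs : s ∈ dLog K) :
    ∃ z : K⸨X⸩, z ≠ 0 ∧ euler K z = s * z := by
  obtain ⟨hneg, m, hm⟩ := hs
  have h1 : s - ((m : ℤ) : K⸨X⸩) ∈ ordGE K 1 := by
    intro l hl
    have : ((m : ℤ) : K⸨X⸩) = HahnSeries.C (m : K) := by simp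
    rw [this, HahnSeries.C_apply, HahnSeries.coeff_sub]
    rcases lt_or_eq_of_le (Int.lt_add_one_iff.mp (show l < 0 + 1 by omega)) with h | h
    · rw [hneg l h, HahnSeries.coeff_single_of_ne h.ne, sub_zero]
    · rw [h, hm, HahnSeries.coeff_single_same, sub_self]
  obtain ⟨z, hz, hz'⟩ := exists_euler_eq_mul_of_mem_ordGE h1
  refine ⟨HahnSeries.single m 1 * z, mul_ne_zero (isUnit_single m).ne_zero hz, ?_⟩
  rw [euler_mul, hz', euler_single]
  ring

end LogDeriv

/-! ### Closedness of submodules and `ϑ`-stable ideals -/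

section Closed
variable {A : Type*} [CommRing A]

theorem exists_coe_of_mem_ordGE {f : A⸨X⸩} (hf : f ∈ ordGE A 0) : ∃ p : A⟦X⟧, (p : A⸨X⸩) = f := by
  refine ⟨PowerSeries.mk fun k => f.coeff k, ?_⟩
  ext l
  rcases lt_or_ge l 0 with hl | hl
  · rw [hf l hl, PowerSeries.coeff_coe, if_pos hl]
  · obtain ⟨m, rfl⟩ := Int.eq_ofNat_of_zero_le hl
    rw [LaurentSeries.coeff_coe_powerSeries, PowerSeries.coeff_mk]

theorem exists_eq_X_pow_mul_of_coe_mem_ordGE {k : ℕ} {p : A⟦X⟧} (hp : (p : A⸨X⸩) ∈ ordGE A k) :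
    ∃ q : A⟦X⟧, p = PowerSeries.X ^ k * q := by
  refine PowerSeries.X_pow_dvd_iff.mpr fun m hm => ?_
  rw [← LaurentSeries.coeff_coe_powerSeries]
  exact hp m (by exact_mod_cast hm)

theorem span_X_le_jacobson : Ideal.span {(PowerSeries.X : A⟦X⟧)} ≤ Ideal.jacobson ⊥ := by
  rw [Ideal.span_singleton_le_iff_mem, Ideal.mem_jacobson_bot]
  intro y
  rw [PowerSeries.isUnit_iff_constantCoeff]
  simp

variable [IsNoetherianRing A] {ι : Type*} [Finite ι]

/-- Over a Noetherian ring `A`, submodules of `A((x))ⁿ` are closed in the `x`-adic topology. -/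
theorem mem_of_forall_exists_sub_mem_ordGE (U : Submodule A⸨X⸩ (ι → A⸨X⸩)) (y : ι → A⸨X⸩)
    (h : ∀ k : ℕ, ∃ u ∈ U, ∀ i, y i - u i ∈ ordGE A k) : y ∈ U := by
  obtain ⟨N, hN⟩ := exists_nat_forall_mem_ordGE y
  set e : A⸨X⸩ := HahnSeries.single (N : ℤ) 1 with he
  have he0 : e ∈ ordGE A N := single_mem_ordGE _ _
  let coeL : (ι → A⟦X⟧) →+ (ι → A⸨X⸩) :=
    (HahnSeries.ofPowerSeries ℤ A).toAddMonoidHom.compLeft ι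
  -- The lattice of power series vectors in `U`. Its quotient is finite over the Noetherian ring
  -- `A⟦X⟧`, hence `X`-adically separated by Krull; inverting `x` then recovers the claim for `U`.
  let U₀ : Submodule A⟦X⟧ (ι → A⟦X⟧) :=
    { U.toAddSubgroup.comap coeL with
      smul_mem' := fun c p hp => by
        have : coeL (c • p) = (c : A⸨X⸩) • coeL p := by
          ext1 i
          exact map_mul (HahnSeries.ofPowerSeries ℤ A) c (p i)
        change coeL (c • p) ∈ U
        rw [this]
        exact U.smul_mem _ hp }
  have hU₀ : ∀ p : ι → A⟦X⟧, p ∈ U₀ ↔ (fun i => (p i : A⸨X⸩)) ∈ U := fun p => Iff.rfl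
  have hy : ∀ i, ∃ p : A⟦X⟧, (p : A⸨X⸩) = e * y i := fun i =>
    exists_coe_of_mem_ordGE (by simpa using mul_mem_ordGE he0 (hN i))
  choose p hp using hy
  have hmem : U₀.mkQ p ∈ (⨅ k : ℕ, Ideal.span {(PowerSeries.X : A⟦X⟧)} ^ k • ⊤ :
      Submodule A⟦X⟧ ((ι → A⟦X⟧) ⧸ U₀)) := by
    rw [Submodule.mem_iInf]
    intro k
    obtain ⟨u, hu, huk⟩ := h k
    have hsub : ∀ i, e * y i - e * u i ∈ ordGE A k := fun i => by
      rw [← mul_sub]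
      exact ordGE_anti (by omega) (mul_mem_ordGE he0 (huk i))
    have hq : ∀ i, ∃ q : A⟦X⟧, (q : A⸨X⸩) = e * u i := fun i =>
      exists_coe_of_mem_ordGE (by
        have h1 := sub_mem (hp i ▸ (show ((p i : A⟦X⟧) : A⸨X⸩) ∈ ordGE A 0 from fun l hl => by
          rw [PowerSeries.coeff_coe, if_pos hl])) (ordGE_anti (by omega) (hsub i))
        rwa [sub_sub_cancel] at h1)
    choose q hq using hq
    have hr : ∀ i, ∃ r : A⟦X⟧, p i - q i = PowerSeries.X ^ k * r := fun i =>
      exists_eq_X_pow_mul_of_coe_mem_ordGE (by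
        rw [PowerSeries.coe_sub, hp, hq]
        exact hsub i)
    choose r hr using hr
    have hqU : q ∈ U₀ := by
      rw [hU₀]
      simp only [hq]
      exact U.smul_mem e hu
    have hpq : p = q + (PowerSeries.X ^ k : A⟦X⟧) • r := by
      ext1 i
      rw [Pi.add_apply, Pi.smul_apply, smul_eq_mul, ← hr]
      ring
    have hq0 : U₀.mkQ q = 0 := (Submodule.Quotient.mk_eq_zero U₀).mpr hqU
    rw [hpq, map_add, hq0, zero_add, map_smul]
    exact Submodule.smul_mem_smul (Ideal.pow_mem_pow (Ideal.mem_span_singleton_self _) k) trivial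
  rw [Ideal.iInf_pow_smul_eq_bot_of_le_jacobson _ span_X_le_jacobson, Submodule.mem_bot] at hmem
  have hpU : p ∈ U₀ := (Submodule.Quotient.mk_eq_zero U₀).mp hmem
  rw [hU₀] at hpU
  simp only [hp] at hpU
  have := U.smul_mem (HahnSeries.single (-(N : ℤ)) 1) hpU
  have heq : (HahnSeries.single (-(N : ℤ)) 1 : A⸨X⸩) • (fun i => e * y i) = y := by
    ext1 i
    rw [Pi.smul_apply, smul_eq_mul, ← mul_assoc, mul_comm _ e, he, single_mul_single_neg, one_mul]
  rwa [heq] at this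

/-- A nonzero ideal of `A((x))` which is stable under `ϑ` contains a nonzero constant. -/
theorem exists_C_mem_of_euler_stable (hA : ∀ k : ℕ, k ≠ 0 → IsUnit (k : A)) (I : Ideal A⸨X⸩)
    (hI : ∀ f ∈ I, euler A f ∈ I) {d : A⸨X⸩} (hd : d ∈ I) (hd0 : d ≠ 0) :
    ∃ a : A, a ≠ 0 ∧ HahnSeries.C a ∈ I := by
  set a := d.coeff d.order with ha
  refine ⟨a, HahnSeries.coeff_order_eq_zero.not.mpr hd0, ?_⟩
  -- Dividing by a power of `x` makes `a` the constant term. The operator `1 - ϑ/(k+1)` fixes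
  -- constants and kills degree `k+1`, so the degrees 1, 2, ... are removed in turn and elements of
  -- `I` converge to `a`.
  have key : ∀ k : ℕ, ∃ u ∈ I, u - HahnSeries.C a ∈ ordGE A (k + 1 : ℕ) := by
    intro k
    induction k with
    | zero =>
      refine ⟨HahnSeries.single (-d.order) 1 * d, I.mul_mem_left _ hd, fun l hl => ?_⟩
      rw [HahnSeries.coeff_sub, coeff_single_mul', one_mul, HahnSeries.C_apply]
      rcases lt_or_eq_of_le (show l ≤ 0 by push_cast at hl; omega) with h | h
      · rw [HahnSeries.coeff_single_of_ne h.ne, sub_zero]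
        exact HahnSeries.coeff_eq_zero_of_lt_order (by omega)
      · rw [h, HahnSeries.coeff_single_same, zero_sub, neg_neg, sub_self]
    | succ k ih =>
      obtain ⟨u, hu, hk⟩ := ih
      obtain ⟨b, hb⟩ := (hA (k + 1) k.succ_ne_zero).exists_right_inv
      refine ⟨u - HahnSeries.C b * euler A u,
        sub_mem hu (I.mul_mem_left _ (hI u hu)), fun l hl => ?_⟩
      set v := u - HahnSeries.C a with hv
      have huv : u = v + HahnSeries.C a := by rw [hv]; ring
      have : u - HahnSeries.C b * euler A u - HahnSeries.C a = v - HahnSeries.C b * euler A v := by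
        rw [huv, map_add, euler_C, add_zero]; ring
      rw [this, HahnSeries.coeff_sub, coeff_C_mul', euler_coeff]
      rcases lt_or_eq_of_le (show l ≤ (k + 1 : ℕ) by push_cast at hl ⊢; omega) with h | h
      · rw [hk l h]; simp
      · rw [h, ← mul_assoc, mul_comm b, Int.cast_natCast, hb, one_mul, sub_self]
  let U : Submodule A⸨X⸩ (Unit → A⸨X⸩) := Submodule.comap
    (LinearMap.proj () : (Unit → A⸨X⸩) →ₗ[A⸨X⸩] A⸨X⸩) I
  have : (fun _ => HahnSeries.C a : Unit → A⸨X⸩) ∈ U := by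
    refine mem_of_forall_exists_sub_mem_ordGE U _ fun k => ?_
    obtain ⟨u, hu, hk⟩ := key k
    refine ⟨fun _ => u, hu, fun _ => ?_⟩
    rw [← neg_sub]
    exact neg_mem (ordGE_anti (by push_cast; omega) hk)
  exact this

end Closed

/-! ### Projections as limits of polynomials in the connection -/

section Projection
open Polynomial

variable {R : Type*} [CommRing R]

theorem laurentMap_injective : Function.Injective (laurentMap R) := fun f g h => by
  ext l
  have := congrArg (fun s : (FractionRing R)⸨X⸩ => s.coeff l) h
  exact IsFractionRing.injective R (FractionRing R) this

theorem laurentMap_single (k : ℤ) (a : R) : laurentMap R (HahnSeries.single k a)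
    = HahnSeries.single k (algebraMap R (FractionRing R) a) := by
  ext l
  rw [laurentMap_coeff]
  by_cases h : l = k
  · rw [h, HahnSeries.coeff_single_same, HahnSeries.coeff_single_same]
  · rw [HahnSeries.coeff_single_of_ne h, HahnSeries.coeff_single_of_ne h, map_zero]

theorem laurentMap_mem_ordGE {k : ℤ} {f : R⸨X⸩} (hf : f ∈ ordGE R k) :
    laurentMap R f ∈ ordGE (FractionRing R) k :=
  fun l hl => by rw [laurentMap_coeff, hf l hl, map_zero]

theorem smul_mem_ordGE {k : ℤ} {c : (FractionRing R)⸨X⸩} (a : R)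
    (hc : c ∈ ordGE (FractionRing R) k) : a • c ∈ ordGE (FractionRing R) k :=
  fun l hl => by rw [HahnSeries.coeff_smul, hc l hl, smul_zero]

/-- The operator `x ^ s (ϑ + g)` on `K((x))`. -/
def twist (s : ℕ) (g : R⸨X⸩) : Module.End R (FractionRing R)⸨X⸩ where
  toFun c := HahnSeries.single (s : ℤ) 1 * (euler (FractionRing R) c + laurentMap R g * c)
  map_add' c c' := by rw [map_add]; ring
  map_smul' a c := by
    have h : ∀ c : (FractionRing R)⸨X⸩,
        a • c = HahnSeries.C (algebraMap R (FractionRing R) a) * c := fun c => by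
      ext l
      rw [coeff_C_mul', HahnSeries.coeff_smul, Algebra.smul_def]
    rw [RingHom.id_apply, h, h, euler_mul, euler_C]
    ring

theorem twist_apply (s : ℕ) (g : R⸨X⸩) (c : (FractionRing R)⸨X⸩) :
    twist s g c = HahnSeries.single (s : ℤ) 1 * (euler (FractionRing R) c + laurentMap R g * c) :=
  rfl

/-- The increment of the eigenvalues of `x ^ s ϑ` on the graded pieces of `K((x))`. -/
def eigenStep (R : Type*) [CommRing R] (s : ℕ) : R := if s = 0 then 1 else 0

/-- The factor `x ^ s` compensates the pole of `g`, so the filtration is preserved and the graded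
pieces see only scalars. For `s > 0`, `x ^ s ϑ` raises the order and contributes nothing. -/
theorem twist_sub_smul_mem {s : ℕ} {g : R⸨X⸩} (hg : g ∈ ordGE R (-s)) {l : ℤ}
    {c : (FractionRing R)⸨X⸩} (hc : c ∈ ordGE (FractionRing R) l) :
    twist s g c - (g.coeff (-s) + eigenStep R s * l) • c ∈ ordGE (FractionRing R) (l + 1) := by
  have hgc := laurentMap_mem_ordGE hg
  intro m hm
  rw [HahnSeries.coeff_sub, HahnSeries.coeff_smul, twist_apply, coeff_single_mul', one_mul,
    HahnSeries.coeff_add, euler_coeff]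
  rcases lt_or_eq_of_le (Int.lt_add_one_iff.mp hm) with h | h
  · rw [hc m h, hc _ (by omega), mul_mem_ordGE hgc hc _ (by omega)]
    simp
  · subst h
    have h1 := coeff_mul_of_mem_ordGE hgc hc
    rw [show m - (s : ℤ) = -s + m by ring, h1, laurentMap_coeff, Algebra.smul_def, map_add,
      add_mul]
    unfold eigenStep
    split_ifs with hs
    · subst hs; simp; ring
    · rw [hc (-s + m) (by omega)]; simp

theorem twist_mem_ordGE {s : ℕ} {g : R⸨X⸩} (hg : g ∈ ordGE R (-s)) {l : ℤ}
    {c : (FractionRing R)⸨X⸩} (hc : c ∈ ordGE (FractionRing R) l) :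
    twist s g c ∈ ordGE (FractionRing R) l := by
  have := add_mem (ordGE_anti (by omega) (twist_sub_smul_mem hg hc))
    (smul_mem_ordGE (g.coeff (-s) + eigenStep R s * l) hc)
  rwa [sub_add_cancel] at this

theorem aeval_twist_mem_ordGE {s : ℕ} {g : R⸨X⸩} (hg : g ∈ ordGE R (-s)) {l : ℤ} (p : R[X]) :
    ∀ {c : (FractionRing R)⸨X⸩}, c ∈ ordGE (FractionRing R) l →
      aeval (twist s g) p c ∈ ordGE (FractionRing R) l := by
  induction p using Polynomial.induction_on with
  | C a =>
    intro c hc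
    rw [aeval_C]
    exact smul_mem_ordGE a hc
  | add p q hp hq =>
    intro c hc
    rw [map_add]
    exact add_mem (hp hc) (hq hc)
  | monomial n a ih =>
    intro c hc
    rw [pow_succ, ← mul_assoc, map_mul, aeval_X]
    exact ih (twist_mem_ordGE hg hc)

/-- The polynomial `∏ (X - β - (l - N) δ)`, `l < n`. -/
def stepPoly (β δ : R) (N n : ℕ) : R[X] :=
  ∏ l ∈ Finset.range n, (X - C (β + δ * ((l : ℤ) - N : ℤ)))

/-- Each factor annihilates one graded piece, hence raises the order by one. -/
theorem aeval_stepPoly_mem_ordGE {s : ℕ} {g : R⸨X⸩} (hg : g ∈ ordGE R (-s)) {N : ℕ}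
    {c : (FractionRing R)⸨X⸩} (hc : c ∈ ordGE (FractionRing R) (-N)) (n : ℕ) :
    aeval (twist s g) (stepPoly (g.coeff (-s)) (eigenStep R s) N n) c
      ∈ ordGE (FractionRing R) ((n : ℤ) - N) := by
  induction n with
  | zero => simpa [stepPoly] using hc
  | succ n ih =>
    have h : stepPoly (g.coeff (-s)) (eigenStep R s) N (n + 1)
        = (X - C (g.coeff (-s) + eigenStep R s * ((n : ℤ) - N : ℤ)))
          * stepPoly (g.coeff (-s)) (eigenStep R s) N n := by
      rw [stepPoly, Finset.prod_range_succ, mul_comm]; rfl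
    rw [h, map_mul, Module.End.mul_apply, map_sub, aeval_X, aeval_C, LinearMap.sub_apply,
      Module.algebraMap_end_apply]
    have := twist_sub_smul_mem hg ih
    rwa [show ((n : ℤ) - N + 1) = ((n + 1 : ℕ) : ℤ) - N by push_cast; ring] at this

variable {ι : Type*} {h : ι → R⸨X⸩} {W : Submodule R⸨X⸩ (ι → (FractionRing R)⸨X⸩)}

/-- The operator `x ^ s (∇ - h i)` preserves `W` and is `twist s (h j - h i)` on component `j`, so
one polynomial acts on all components at once. -/
theorem aeval_twist_mem
    (hD : ∀ v ∈ W, (fun j => euler (FractionRing R) (v j) + laurentMap R (h j) * v j) ∈ W)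
    (s : ℕ) (i : ι) (p : R[X]) : ∀ v ∈ W, (fun j => aeval (twist s (h j - h i)) p (v j)) ∈ W := by
  induction p using Polynomial.induction_on with
  | C a =>
    intro v hv
    have := W.smul_mem (HahnSeries.C a) hv
    convert this using 1
    ext1 j
    rw [aeval_C, Module.algebraMap_end_apply, Pi.smul_apply, smul_eq_laurentMap_mul,
      HahnSeries.C_apply, laurentMap_single, ← HahnSeries.C_apply]
    ext l
    rw [coeff_C_mul', HahnSeries.coeff_smul, Algebra.smul_def]
  | add p q hp hq =>
    intro v hv
    have := add_mem (hp v hv) (hq v hv)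
    convert this using 1
    ext1 j
    rw [map_add]; rfl
  | monomial n a ih =>
    intro v hv
    have h1 : (fun j => twist s (h j - h i) (v j)) ∈ W := by
      have := W.smul_mem (HahnSeries.single (s : ℤ) 1) (sub_mem (hD v hv) (W.smul_mem (h i) hv))
      convert this using 1
      ext1 j
      rw [Pi.smul_apply, Pi.sub_apply, Pi.smul_apply, smul_eq_laurentMap_mul,
        smul_eq_laurentMap_mul, laurentMap_single, map_one, twist_apply, map_sub]
      ring
    have := ih _ h1
    convert this using 1
    ext1 j
    rw [pow_succ, ← mul_assoc, map_mul, aeval_X]; rfl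

/-- If coprime polynomials `p` and `q` in an operator are small on `c` and `c'`, then a single
polynomial in the operator is close to the identity on `c` and small on `c'`. -/
theorem sub_aeval_mul_mem_ordGE {s : ℕ} {g : R⸨X⸩} (hg : g ∈ ordGE R (-s)) {k : ℤ} {a b p q : R[X]}
    (hab : a * p + b * q = 1) {c : (FractionRing R)⸨X⸩}
    (hc : aeval (twist s g) p c ∈ ordGE (FractionRing R) k) :
    c - aeval (twist s g) (b * q) c ∈ ordGE (FractionRing R) k := by
  have h1 : c = aeval (twist s g) (a * p + b * q) c := by rw [hab, map_one]; rfl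
  have h2 : c - aeval (twist s g) (b * q) c = aeval (twist s g) (a * p) c := by
    nth_rw 1 [h1]
    rw [map_add, LinearMap.add_apply, add_sub_cancel_right]
  rw [h2, map_mul]
  exact aeval_twist_mem_ordGE hg a hc

theorem isCoprime_X_sub_C {a b : R} (h : IsUnit (a - b)) : IsCoprime (X - C a) (X - C b) :=
  isCoprime_X_sub_C_of_isUnit_sub h

/-- `W` contains the limits of its elements in the `x`-adic topology. -/
def IsXClosed (W : Submodule R⸨X⸩ (ι → (FractionRing R)⸨X⸩)) : Prop :=
  ∀ v : ι → (FractionRing R)⸨X⸩,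
    (∀ k : ℕ, ∃ w ∈ W, ∀ j, v j - w j ∈ ordGE (FractionRing R) k) → v ∈ W

/-- Separation of the components for which `h j - h i` has a pole of order `s`. -/
theorem exists_mem_kill_step [Finite ι] (hW : IsXClosed W)
    (hD : ∀ v ∈ W, (fun j => euler (FractionRing R) (v j) + laurentMap R (h j) * v j) ∈ W)
    (i : ι) (r : ι → ℕ) (hr : ∀ j, j ≠ i → h j - h i ∈ ordGE R (-r j))
    (hu : ∀ j, j ≠ i → IsUnit ((h j - h i).coeff (-r j)))
    (hu0 : ∀ j, j ≠ i → r j = 0 → ∀ m : ℤ, IsUnit ((h j - h i).coeff 0 + m))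
    (s : ℕ) {w : ι → (FractionRing R)⸨X⸩} (hw : w ∈ W) (hws : ∀ j, j ≠ i → s < r j → w j = 0) :
    ∃ w' ∈ W, w' i = w i ∧ ∀ j, j ≠ i → s ≤ r j → w' j = 0 := by
  classical
  cases nonempty_fintype ι
  refine ⟨fun j => if j ≠ i ∧ s ≤ r j then 0 else w j, hW _ fun k => ?_, by simp, fun j hj hs => by
    simp [hj, hs]⟩
  obtain ⟨N, hN⟩ := exists_nat_forall_mem_ordGE w
  set J : Finset ι := Finset.univ.filter fun j => j ≠ i ∧ r j = s with hJ
  -- With `N + k` factors the order rises from `-N` to `k`. The polynomial `p` serves component `i`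
  -- and those with pole order below `s`, `Q j` those with pole order exactly `s`.
  set p : R[X] := stepPoly 0 (eigenStep R s) N (N + k) with hp
  set Q : ι → R[X] := fun j => stepPoly ((h j - h i).coeff (-s)) (eigenStep R s) N (N + k) with hQ
  -- Up to sign, roots of `p` and `Q j` differ by the leading coefficient of `h j - h i` if `s > 0`,
  -- and by its constant term plus an integer if `s = 0`. The integer shifts in the turning point
  -- condition are needed for the latter.
  have hcop : IsCoprime p (∏ j ∈ J, Q j) := by
    refine IsCoprime.prod_right fun j hj => IsCoprime.prod_left fun l _ =>
      IsCoprime.prod_right fun l' _ => isCoprime_X_sub_C ?_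
    obtain ⟨hji, hjs⟩ := (Finset.mem_filter.mp hj).2
    unfold eigenStep
    split_ifs with hs
    · subst hs
      have := (hu0 j hji hjs (l' - l)).neg
      convert this using 1
      push_cast
      simp
      ring
    · have := (hu j hji).neg
      rw [hjs] at this
      convert this using 1
      ring
  obtain ⟨a, b, hab⟩ := hcop
  -- This polynomial is `1` modulo `p` and `0` modulo each `Q j`.
  refine ⟨_, aeval_twist_mem hD s i (b * ∏ j ∈ J, Q j) w hw, fun j => ?_⟩
  have hNk : (((N + k : ℕ) : ℤ) - N) = k := by push_cast; ring
  rcases em (j ≠ i ∧ s ≤ r j) with hj | hj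
  · rw [if_pos hj]
    rcases lt_or_eq_of_le hj.2 with hlt | heq
    · rw [hws j hj.1 hlt, map_zero, sub_zero]
      exact zero_mem _
    · have hmem : h j - h i ∈ ordGE R (-s) := by rw [heq]; exact hr j hj.1
      have hjJ : j ∈ J := Finset.mem_filter.mpr ⟨Finset.mem_univ _, hj.1, heq.symm⟩
      rw [zero_sub, ← Finset.prod_erase_mul _ _ hjJ, ← mul_assoc, map_mul]
      refine neg_mem (aeval_twist_mem_ordGE hmem _ ?_)
      have := aeval_stepPoly_mem_ordGE hmem (hN j) (N + k)
      rwa [hNk] at this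
  · rw [if_neg hj]
    have hmem : h j - h i ∈ ordGE R (-s) ∧ (h j - h i).coeff (-s) = 0 := by
      by_cases hji : j = i
      · subst hji
        rw [sub_self]
        exact ⟨zero_mem _, rfl⟩
      · have hlt : r j < s := not_le.mp fun hs => hj ⟨hji, hs⟩
        exact ⟨ordGE_anti (by omega) (hr j hji), hr j hji _ (by omega)⟩
    refine sub_aeval_mul_mem_ordGE hmem.1 hab ?_
    have := aeval_stepPoly_mem_ordGE hmem.1 (hN j) (N + k)
    rwa [hNk, hmem.2] at this

/-- A closed submodule which is stable under the connection `ϑ + diag(h)` without turning point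
contains the components of its elements. -/
theorem single_mem_of_mem [Finite ι] [DecidableEq ι] (hW : IsXClosed W)
    (hD : ∀ v ∈ W, (fun j => euler (FractionRing R) (v j) + laurentMap R (h j) * v j) ∈ W)
    (i : ι) (r : ι → ℕ) (hr : ∀ j, j ≠ i → h j - h i ∈ ordGE R (-r j))
    (hu : ∀ j, j ≠ i → IsUnit ((h j - h i).coeff (-r j)))
    (hu0 : ∀ j, j ≠ i → r j = 0 → ∀ m : ℤ, IsUnit ((h j - h i).coeff 0 + m))
    {v : ι → (FractionRing R)⸨X⸩} (hv : v ∈ W) : Pi.single i (v i) ∈ W := by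
  cases nonempty_fintype ι
  -- Descending induction on `s`, starting above all pole orders: the operator of level `s` respects
  -- the filtration only on components with pole order at most `s`, so larger poles are removed
  -- first.
  have key : ∀ t s : ℕ, s + t = ∑ j, r j + 1 →
      ∃ w ∈ W, w i = v i ∧ ∀ j, j ≠ i → s ≤ r j → w j = 0 := by
    intro t
    induction t with
    | zero =>
      intro s hs
      refine ⟨v, hv, rfl, fun j _ hj => ?_⟩
      have := Finset.single_le_sum (f := r) (fun _ _ => Nat.zero_le _) (Finset.mem_univ j)
      omega
    | succ t ih =>
      intro s hs
      obtain ⟨w, hw, hwi, hw0⟩ := ih (s + 1) (by omega)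
      obtain ⟨w', hw', hwi', hw0'⟩ :=
        exists_mem_kill_step hW hD i r hr hu hu0 s hw fun j hj hlt => hw0 j hj hlt
      exact ⟨w', hw', hwi'.trans hwi, hw0'⟩
  obtain ⟨w, hw, hwi, hw0⟩ := key _ 0 (zero_add _)
  convert hw using 1
  ext1 j
  by_cases hj : j = i
  · subst hj; rw [Pi.single_eq_same, hwi]
  · rw [Pi.single_eq_of_ne hj, hw0 j hj (Nat.zero_le _)]

theorem aeval_twist_zero_coeff (p : R[X]) : ∀ (c : (FractionRing R)⸨X⸩) (l : ℤ),
    (aeval (twist 0 (0 : R⸨X⸩)) p c).coeff l = algebraMap R (FractionRing R) (p.eval (l : R))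
      * c.coeff l := by
  induction p using Polynomial.induction_on with
  | C a =>
    intro c l
    rw [aeval_C, eval_C, Module.algebraMap_end_apply, HahnSeries.coeff_smul, Algebra.smul_def]
  | add p q hp hq =>
    intro c l
    rw [map_add, LinearMap.add_apply, HahnSeries.coeff_add, hp, hq, eval_add, map_add, add_mul]
  | monomial n a ih =>
    intro c l
    rw [pow_succ, ← mul_assoc, map_mul, aeval_X, Module.End.mul_apply, ih, eval_mul_X,
      map_mul, mul_assoc, twist_apply, map_zero, zero_mul, add_zero, Nat.cast_zero,
      coeff_single_mul', one_mul, sub_zero, euler_coeff, map_intCast]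

/-- A closed submodule which is stable under the connection `ϑ + diag(h)` contains the constant
terms of those of its elements which have a single component. -/
theorem single_C_coeff_mem (hR : ∀ k : ℤ, k ≠ 0 → IsUnit (k : R)) [DecidableEq ι]
    (hW : IsXClosed W)
    (hD : ∀ v ∈ W, (fun j => euler (FractionRing R) (v j) + laurentMap R (h j) * v j) ∈ W)
    (i : ι) {c : (FractionRing R)⸨X⸩} (hc : Pi.single i c ∈ W) (m : ℤ) :
    Pi.single i (HahnSeries.C (c.coeff m)) ∈ W := by
  suffices hs : Pi.single i (HahnSeries.single m (c.coeff m)) ∈ W by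
    have := W.smul_mem (HahnSeries.single (-m) 1) hs
    rwa [← Pi.single_smul, smul_eq_laurentMap_mul, laurentMap_single, map_one,
      HahnSeries.single_mul_single, neg_add_cancel, one_mul, ← HahnSeries.C_apply] at this
  obtain ⟨N, hN⟩ := exists_nat_forall_mem_ordGE fun _ : Unit => c
  specialize hN ()
  refine hW _ fun k => ?_
  -- On component `i`, `∇ - h i` is `ϑ`, with eigenvalue `l` in degree `l`. Nonzero integers being
  -- units, a polynomial can equal `1` at `m` and `0` at the other degrees in `[-N, k)`.
  set L : Finset ℤ := (Finset.Ico (-(N : ℤ)) k).erase m with hL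
  have hcop : IsCoprime (X - C (m : R)) (∏ l ∈ L, (X - C (l : R))) := by
    refine IsCoprime.prod_right fun l hl => isCoprime_X_sub_C ?_
    rw [← Int.cast_sub]
    exact hR _ (sub_ne_zero.mpr (Finset.ne_of_mem_erase hl).symm)
  obtain ⟨a, b, hab⟩ := hcop
  set q := b * ∏ l ∈ L, (X - C (l : R)) with hq
  refine ⟨_, aeval_twist_mem hD 0 i q _ hc, fun j => ?_⟩
  by_cases hj : j = i
  · subst hj
    rw [Pi.single_eq_same, Pi.single_eq_same, sub_self]
    intro l hl
    rw [HahnSeries.coeff_sub, aeval_twist_zero_coeff]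
    by_cases hlm : l = m
    · subst hlm
      have : q.eval (l : R) = 1 := by
        have := congrArg (eval (l : R)) hab
        simpa using this
      rw [HahnSeries.coeff_single_same, this, map_one, one_mul, sub_self]
    · rw [HahnSeries.coeff_single_of_ne hlm]
      rcases lt_or_ge l (-N) with h1 | h1
      · rw [hN l h1, mul_zero, sub_zero]
      · have hlL : l ∈ L := Finset.mem_erase.mpr ⟨hlm, Finset.mem_Ico.mpr ⟨h1, hl⟩⟩
        have : q.eval (l : R) = 0 := by
          rw [hq, eval_mul, eval_prod, Finset.prod_eq_zero hlL (by simp), mul_zero]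
        rw [this, map_zero, zero_mul, sub_zero]
  · rw [Pi.single_eq_of_ne hj, Pi.single_eq_of_ne hj, map_zero, sub_zero]
    exact zero_mem _

end Projection

/-! ### A free submodule of full rank -/

section Generic

/-- A finite module of rank `n` over a domain contains a free module of rank `n`, up to torsion. -/
theorem exists_linearIndependent_smul_mem_span {S M : Type*} [CommRing S] [IsDomain S]
    [AddCommGroup M] [Module S M] [Module.Finite S M] {n : ℕ} (hn : Module.finrank S M = n) :
    ∃ g : Fin n → M, LinearIndependent S g ∧
      ∃ d : S, d ≠ 0 ∧ ∀ v, d • v ∈ Submodule.span S (Set.range g) := by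
  classical
  obtain ⟨g, hg⟩ := exists_linearIndependent_of_le_finrank (R := S) (M := M) hn.ge
  refine ⟨g, hg, ?_⟩
  have h1 : ∀ v, ∃ d : S, d ≠ 0 ∧ d • v ∈ Submodule.span S (Set.range g) := by
    intro v
    by_contra! hv
    have hli : LinearIndependent S (Fin.cons v g : Fin (n + 1) → M) := by
      refine LinearIndependent.finCons' v g hg fun c y hy hcy => ?_
      by_contra hc
      refine hv c hc ?_
      rw [eq_neg_of_add_eq_zero_left hcy]
      exact neg_mem hy
    have := hli.fintype_card_le_finrank
    rw [Fintype.card_fin, hn] at this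
    omega
  choose d hd hdv using h1
  obtain ⟨s, hs⟩ := Module.Finite.fg_top (R := S) (M := M)
  refine ⟨∏ v ∈ s, d v, Finset.prod_ne_zero_iff.mpr fun v _ => hd v, fun v => ?_⟩
  have hle : Submodule.span S (s : Set M)
      ≤ (Submodule.span S (Set.range g)).comap (LinearMap.lsmul S M (∏ v ∈ s, d v)) := by
    rw [Submodule.span_le]
    intro w hw
    change (∏ v ∈ s, d v) • w ∈ Submodule.span S (Set.range g)
    rw [← Finset.prod_erase_mul _ _ hw, mul_smul]
    exact Submodule.smul_mem _ _ (hdv w)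
  exact hle (hs ▸ Submodule.mem_top)

end Generic

/-! ### Eigenvectors of a connection over `K((x))` -/

section Eigen
variable {K : Type*} [Field K] {V : Type*} [AddCommGroup V] [Module K⸨X⸩ V]

/-- Horizontal vectors of twists by distinct characters are linearly independent. -/
theorem linearIndependent_of_nabla_eq_smul (D : Connection K V) {ι : Type*} {h : ι → K⸨X⸩}
    {e : ι → V} (he : ∀ i, e i ≠ 0) (hD : ∀ i, D.nabla (e i) = h i • e i)
    (hh : ∀ i j, i ≠ j → h i - h j ∈ invPoly K) (hZ : ∀ i j, i ≠ j → h i - h j ∉ intConst K) :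
    LinearIndependent K⸨X⸩ e := by
  classical
  rw [linearIndependent_iff']
  intro s
  induction s using Finset.induction_on with
  | empty => simp
  | insert a s ha ih =>
    intro g hg
    rw [Finset.sum_insert ha] at hg
    have hga : g a = 0 := by
      by_contra hga
      set c : ι → K⸨X⸩ := fun j => (g a)⁻¹ * g j with hc
      have h1 : e a = -∑ j ∈ s, c j • e j := by
        rw [eq_neg_iff_add_eq_zero, ← smul_zero (g a)⁻¹, ← hg, smul_add, smul_smul,
          inv_mul_cancel₀ hga, one_smul, Finset.smul_sum]
        simp only [hc, mul_smul]
      -- Applying `∇ - h a` to the relation removes `e a`. By induction `ϑ c_j = (h a - h j) c_j`,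
      -- and a nonzero `c_j` would make `h a - h j` an integer.
      have h2 : ∑ j ∈ s, (euler K (c j) + (h j - h a) * c j) • e j = 0 := by
        have h3 : D.nabla (∑ j ∈ s, c j • e j) = h a • ∑ j ∈ s, c j • e j := by
          rw [← neg_eq_iff_eq_neg.mpr h1, map_neg, hD, smul_neg]
        rw [map_sum, Finset.smul_sum, ← sub_eq_zero, ← Finset.sum_sub_distrib] at h3
        rw [← h3]
        refine Finset.sum_congr rfl fun j _ => ?_
        rw [D.leibniz, hD]
        rw [add_smul, sub_mul, sub_smul, smul_smul, smul_smul, mul_comm (c j) (h j)]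
        abel
      have h4 : ∀ j ∈ s, c j = 0 := by
        intro j hj
        by_contra hcj
        have haj : a ≠ j := fun h => ha (h ▸ hj)
        refine hZ a j haj (mem_intConst_of_euler_eq_mul (hh a j haj) hcj ?_)
        have := ih _ h2 j hj
        linear_combination this
      refine he a ?_
      rw [h1, Finset.sum_eq_zero fun j hj => by rw [h4 j hj, zero_smul], neg_zero]
    rw [hga, zero_smul, zero_add] at hg
    intro i hi
    rcases Finset.mem_insert.mp hi with rfl | hi
    · exact hga
    · exact ih g hg i hi

/-- Take the last nonzero iterate of `v` under `∇ - f`. -/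
theorem exists_shift_eq_zero (D : Connection K V) (f : K⸨X⸩) (q : ℕ) :
    ∀ v : V, v ≠ 0 → (D.shift f)^[q] v = 0 → ∃ w, w ≠ 0 ∧ D.shift f w = 0 := by
  induction q with
  | zero => intro v hv h; exact absurd h hv
  | succ q ih =>
    intro v hv h
    rw [Function.iterate_succ_apply] at h
    by_cases h0 : D.shift f v = 0
    · exact ⟨v, hv, h0⟩
    · exact ih _ h0 h

theorem sub_mem_intConst_of_charClass_eq {A : Type*} [CommRing A] {f g : invPoly A}
    (h : charClass f = charClass g) : (f : A⸨X⸩) - g ∈ intConst A := by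
  have h1 := QuotientAddGroup.eq.mp h.symm
  have h2 : ((-g + f : invPoly A) : A⸨X⸩) ∈ intConst A := h1
  rwa [AddSubgroup.coe_add, AddSubgroup.coe_neg, neg_add_eq_sub] at h2

theorem charClass_eq_of_sub_mem_intConst {A : Type*} [CommRing A] {f g : invPoly A}
    (h : (f : A⸨X⸩) - g ∈ intConst A) : charClass f = charClass g := by
  refine (QuotientAddGroup.eq.mpr ?_).symm
  change ((-g + f : invPoly A) : A⸨X⸩) ∈ intConst A
  rwa [AddSubgroup.coe_add, AddSubgroup.coe_neg, neg_add_eq_sub]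

theorem intCast_eq_C {A : Type*} [CommRing A] (m : ℤ) :
    ((m : ℤ) : A⸨X⸩) = HahnSeries.C (m : A) := by simp

theorem intConst_le_dLog (A : Type*) [CommRing A] : intConst A ≤ dLog A := by
  rintro _ ⟨m, rfl⟩
  change ((m : ℤ) : A⸨X⸩) ∈ dLog A
  rw [intCast_eq_C, HahnSeries.C_apply]
  exact ⟨fun k hk => HahnSeries.coeff_single_of_ne hk.ne, m, HahnSeries.coeff_single_same _ _⟩

/-- Every character of a TLJ-decomposition comes with a horizontal vector. -/
theorem exists_nabla_eq_smul_of_mem [CharZero K] {D : Connection K V} {Φ : Set (CharGroup K)}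
    {F : CharGroup K → Submodule K⸨X⸩ V} (hT : D.IsTLJDecomposition Φ F) {g : invPoly K}
    (hg : charClass g ∈ Φ) : ∃ e, e ≠ 0 ∧ D.nabla e = (g : K⸨X⸩) • e := by
  obtain ⟨f, ⟨g', hg', hf⟩, q, hq⟩ := hT.eq_kerSpan _ hg
  have hne : D.kerSpan f q ≠ ⊥ := hq q le_rfl ▸ hT.ne_bot _ hg
  rw [Connection.kerSpan, Ne, Submodule.span_eq_bot] at hne
  push Not at hne
  obtain ⟨v, hv, hv0⟩ := hne
  obtain ⟨w, hw, hw0⟩ := exists_shift_eq_zero D f q v hv0 hv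
  have hs : (g : K⸨X⸩) - f ∈ dLog K := by
    have := add_mem (intConst_le_dLog K (sub_mem_intConst_of_charClass_eq hg'.symm)) (neg_mem hf)
    rwa [neg_sub, sub_add_sub_cancel] at this
  obtain ⟨z, hz, hz'⟩ := exists_euler_eq_mul_of_mem_dLog hs
  refine ⟨z • w, smul_ne_zero hz hw, ?_⟩
  have hw1 : D.nabla w = f • w := sub_eq_zero.mp hw0
  rw [D.leibniz, hw1, hz']
  rw [smul_smul, smul_smul, ← add_smul]
  congr 1
  ring

end Eigen

/-! ### Descent of the diagonal form to `R((x))` -/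

section Descent
variable {R : Type*} [CommRing R]

theorem isUnit_coeff_zero_of_isUnit [IsDomain R] {f : R⸨X⸩} (hf : IsUnit f) (h1 : f ∈ invPoly R)
    (h2 : f ∈ ordGE R 0) : IsUnit (f.coeff 0) := by
  have h := isUnit_coeff_order hf
  have h0 : f.order = 0 := by
    rcases lt_trichotomy f.order 0 with hl | hl | hl
    · exact absurd (h2 _ hl) h.ne_zero
    · exact hl
    · exact absurd (h1 _ hl) h.ne_zero
  rwa [h0] at h

/-- The support is already well-ordered in `K((x))`, so integrality of the coefficients suffices. -/
theorem exists_laurentMap_eq {c : (FractionRing R)⸨X⸩}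
    (hc : ∀ l, ∃ a : R, algebraMap R (FractionRing R) a = c.coeff l) :
    ∃ f : R⸨X⸩, laurentMap R f = c := by
  choose a ha using hc
  refine ⟨⟨a, c.isPWO_support.mono fun l hl h0 => hl ?_⟩, ?_⟩
  · refine IsFractionRing.injective R (FractionRing R) ?_
    rw [ha, h0, map_zero]
  · ext l
    rw [laurentMap_coeff, ← ha]

theorem mem_ordGE_of_laurentMap {k : ℤ} {f : R⸨X⸩}
    (hf : laurentMap R f ∈ ordGE (FractionRing R) k) : f ∈ ordGE R k := fun l hl => by
  have := hf l hl
  rw [laurentMap_coeff] at this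
  exact IsFractionRing.injective R (FractionRing R) (this.trans (map_zero _).symm)

/-- The splitting of a connection over `R((x))` which embeds, with closed image, into a split
connection over `K((x))` without turning point. -/
theorem exists_basis_of_embedding [IsDomain R] [IsPrincipalIdealRing R]
    (hR : ∀ k : ℤ, k ≠ 0 → IsUnit (k : R))
    {E : Type*} [AddCommGroup E] [Module R⸨X⸩ E] (D : Connection R E)
    {n : ℕ} {h : Fin n → R⸨X⸩} (hinv : ∀ i, h i ∈ invPoly R)
    (hu : ∀ i j, i ≠ j → ∀ m : ℤ, IsUnit (h i - h j + (m : R⸨X⸩)))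
    (T : E →ₗ[R⸨X⸩] (Fin n → (FractionRing R)⸨X⸩)) (hT : Function.Injective T)
    (hcl : IsXClosed (LinearMap.range T))
    (hD : ∀ w j, T (D.nabla w) j = euler (FractionRing R) (T w j) + laurentMap R (h j) * T w j)
    (hb : ∀ i, ∃ κ : FractionRing R, κ ≠ 0 ∧ ∀ w a, T w = Pi.single i (HahnSeries.C a) →
      ∃ s : R, algebraMap R (FractionRing R) s = a * κ)
    (hne : ∀ i, ∃ w, T w i ≠ 0) :
    ∃ u : Module.Basis (Fin n) R⸨X⸩ E, ∀ i, D.nabla (u i) = h i • u i := by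
  have hD' : ∀ v ∈ LinearMap.range T,
      (fun j => euler (FractionRing R) (v j) + laurentMap R (h j) * v j) ∈ LinearMap.range T := by
    rintro _ ⟨w, rfl⟩
    exact ⟨D.nabla w, funext (hD w)⟩
  have hproj : ∀ w i m, ∃ w', T w' = Pi.single i (HahnSeries.C ((T w i).coeff m)) := by
    intro w i m
    -- The differences lie in `R[x⁻¹]`, so `-order` is a natural number and serves as pole order.
    have hord : ∀ j, j ≠ i → (h j - h i).order ≤ 0 := fun j hj => not_lt.mp fun hlt => by
      have h0 : IsUnit (h j - h i) := by simpa using hu j i hj 0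
      exact (isUnit_coeff_order h0).ne_zero (sub_mem (hinv j) (hinv i) _ hlt)
    refine single_C_coeff_mem hR hcl hD' i (single_mem_of_mem hcl hD' i
      (fun j => (-(h j - h i).order).toNat) (fun j hj => ?_) (fun j hj => ?_)
      (fun j hj hj0 m => ?_) ⟨w, rfl⟩) m
    · have := hord j hj
      rw [Int.toNat_of_nonneg (by omega), neg_neg]
      exact fun l hl => HahnSeries.coeff_eq_zero_of_lt_order hl
    · have := hord j hj
      rw [Int.toNat_of_nonneg (by omega), neg_neg]
      exact isUnit_coeff_order (by simpa using hu j i hj 0)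
    · have h0 : (h j - h i).order = 0 := by have := hord j hj; omega
      have := isUnit_coeff_zero_of_isUnit (hu j i hj m)
        (add_mem (sub_mem (hinv j) (hinv i)) fun l hl => by
          rw [intCast_eq_C, HahnSeries.C_apply, HahnSeries.coeff_single_of_ne hl.ne'])
        (add_mem (fun l hl => HahnSeries.coeff_eq_zero_of_lt_order (by omega))
          (intCast_eq_C (A := R) m ▸ C_mem_ordGE _))
      rwa [HahnSeries.coeff_add, intCast_eq_C, HahnSeries.C_apply, HahnSeries.coeff_single_same]
        at this
  have hsmul : ∀ (f : R⸨X⸩) (i : Fin n) (c : (FractionRing R)⸨X⸩),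
      f • (Pi.single i c : Fin n → (FractionRing R)⸨X⸩) = Pi.single i (laurentMap R f * c) :=
    fun f i c => by
    ext1 j
    rw [Pi.smul_apply, smul_eq_laurentMap_mul]
    by_cases hj : j = i
    · subst hj; rw [Pi.single_eq_same, Pi.single_eq_same]
    · rw [Pi.single_eq_of_ne hj, Pi.single_eq_of_ne hj, mul_zero]
  have hCmul : ∀ (s : R) (a : FractionRing R), laurentMap R (HahnSeries.C s) * HahnSeries.C a
      = HahnSeries.C (algebraMap R (FractionRing R) s * a) := fun s a => by
    rw [HahnSeries.C_apply, laurentMap_single, ← HahnSeries.C_apply, map_mul]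
  -- the module of constant multiples of the `i`-th vector is principal
  have hprin : ∀ i, ∃ (τ : FractionRing R) (u : E), τ ≠ 0 ∧ T u = Pi.single i (HahnSeries.C τ) ∧
      ∀ w a, T w = Pi.single i (HahnSeries.C a) →
        ∃ s : R, algebraMap R (FractionRing R) s * τ = a := by
    intro i
    obtain ⟨κ, hκ, hκ'⟩ := hb i
    -- Multiplication by `κ` turns the module of constants into an ideal of `R`; a generator `ρ` of
    -- it gives `τ = ρ κ⁻¹`.
    let J : Ideal R :=
      { carrier := {s | ∃ w, T w
          = Pi.single i (HahnSeries.C (algebraMap R (FractionRing R) s * κ⁻¹))}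
        zero_mem' := ⟨0, by simp⟩
        add_mem' := by
          rintro s s' ⟨w, hw⟩ ⟨w', hw'⟩
          exact ⟨w + w', by rw [map_add, hw, hw', ← Pi.single_add, ← map_add HahnSeries.C,
            map_add (algebraMap R _), add_mul]⟩
        smul_mem' := by
          rintro s s' ⟨w, hw⟩
          exact ⟨(HahnSeries.C s : R⸨X⸩) • w, by
            rw [map_smul, hw, hsmul, hCmul, smul_eq_mul, map_mul (algebraMap R _), mul_assoc]⟩ }
    obtain ⟨ρ, hρ⟩ := (IsPrincipalIdealRing.principal J).principal
    have hJ : ∀ w a, T w = Pi.single i (HahnSeries.C a) →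
        ∃ s : R, algebraMap R (FractionRing R) s * (algebraMap R (FractionRing R) ρ * κ⁻¹) = a := by
      intro w a hw
      obtain ⟨s, hs⟩ := hκ' w a hw
      have hsJ : s ∈ J := ⟨w, by rw [hw, hs, mul_inv_cancel_right₀ hκ]⟩
      rw [hρ, Submodule.mem_span_singleton] at hsJ
      obtain ⟨c, rfl⟩ := hsJ
      refine ⟨c, ?_⟩
      rw [smul_eq_mul, map_mul] at hs
      rw [← mul_assoc, hs, mul_inv_cancel_right₀ hκ]
    have hρJ : ρ ∈ J := hρ ▸ Submodule.mem_span_singleton_self ρ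
    obtain ⟨u, hu⟩ := hρJ
    refine ⟨_, u, fun h0 => ?_, hu, hJ⟩
    obtain ⟨w, hw⟩ := hne i
    refine hw (HahnSeries.ext (funext fun m => ?_))
    obtain ⟨w', hw'⟩ := hproj w i m
    obtain ⟨s, hs⟩ := hJ w' _ hw'
    rw [← hs, h0, mul_zero, HahnSeries.coeff_zero]
  choose τ u hτ hu hJ using hprin
  have hsum : ∀ (f : Fin n → R⸨X⸩) (i : Fin n),
      T (∑ j, f j • u j) i = laurentMap R (f i) * HahnSeries.C (τ i) := by
    intro f i
    rw [map_sum, Finset.sum_apply, Finset.sum_eq_single i]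
    · rw [map_smul, hu, hsmul, Pi.single_eq_same]
    · intro j _ hj
      rw [map_smul, hu, hsmul, Pi.single_eq_of_ne hj.symm]
    · exact fun hi => absurd (Finset.mem_univ i) hi
  have hli : LinearIndependent R⸨X⸩ u := by
    rw [Fintype.linearIndependent_iff]
    intro f hf i
    have h1 := hsum f i
    rw [hf, map_zero, Pi.zero_apply] at h1
    refine laurentMap_injective ?_
    rw [map_zero]
    refine (mul_eq_zero.mp h1.symm).resolve_right fun h2 => hτ i ?_
    exact HahnSeries.C_injective (h2.trans (map_zero _).symm)
  have hspan : ⊤ ≤ Submodule.span R⸨X⸩ (Set.range u) := by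
    intro w _
    -- Every coefficient of `T w i` is itself a constant occurring in the image, hence a multiple of
    -- `τ i` by an element of `R`.
    have hf : ∀ i, ∃ f : R⸨X⸩, laurentMap R f = T w i * HahnSeries.C (τ i)⁻¹ := fun i =>
      exists_laurentMap_eq fun l => by
        obtain ⟨w', hw'⟩ := hproj w i l
        obtain ⟨s, hs⟩ := hJ i w' _ hw'
        refine ⟨s, ?_⟩
        rw [mul_comm, coeff_C_mul', ← hs, mul_comm, mul_inv_cancel_right₀ (hτ i)]
    choose f hf using hf
    have : w = ∑ j, f j • u j := hT (funext fun i => by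
      rw [hsum, hf, mul_assoc, ← map_mul, inv_mul_cancel₀ (hτ i), map_one, mul_one])
    rw [this]
    exact Submodule.sum_mem _ fun j _ => Submodule.smul_mem _ _ (Submodule.subset_span ⟨j, rfl⟩)
  refine ⟨Module.Basis.mk hli hspan, fun i => hT (funext fun j => ?_)⟩
  rw [Module.Basis.mk_apply, hD, map_smul, hu, hsmul]
  by_cases hj : j = i
  · subst hj
    rw [Pi.single_eq_same, Pi.single_eq_same, euler_C, zero_add]
  · rw [Pi.single_eq_of_ne hj, Pi.single_eq_of_ne hj, map_zero, mul_zero, add_zero]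

end Descent

/-! ### Embedding `E` in `K((x))ⁿ` with closed image -/

section Embedding
variable {R : Type*} [CommRing R] {E : Type*} [AddCommGroup E] [Module R⸨X⸩ E]
  {V : Type*} [AddCommGroup V] [Module (FractionRing R)⸨X⸩ V] {ι : E →+ V}

theorem laurentMap_ne_zero {f : R⸨X⸩} (hf : f ≠ 0) : laurentMap R f ≠ 0 :=
  fun h => hf (laurentMap_injective (h.trans (map_zero _).symm))

theorem map_sum_of_semilinear (hι : ∀ f w, ι (f • w) = laurentMap R f • ι w) {n : ℕ}
    (f : Fin n → R⸨X⸩) (g : Fin n → E) :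
    ι (∑ a, f a • g a) = ∑ a, laurentMap R (f a) • ι (g a) := by
  rw [map_sum]
  exact Finset.sum_congr rfl fun a _ => hι _ _

theorem span_map_eq_top [IsDomain R] (hι : ∀ f w, ι (f • w) = laurentMap R f • ι w)
    (hspan : Submodule.span (FractionRing R)⸨X⸩ (Set.range ι) = ⊤) {n : ℕ} {g : Fin n → E}
    {d : R⸨X⸩} (hd : d ≠ 0) (hdg : ∀ v, d • v ∈ Submodule.span R⸨X⸩ (Set.range g)) :
    Submodule.span (FractionRing R)⸨X⸩ (Set.range fun a => ι (g a)) = ⊤ := by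
  rw [eq_top_iff, ← hspan, Submodule.span_le]
  rintro _ ⟨v, rfl⟩
  obtain ⟨f, hf⟩ := (Submodule.mem_span_range_iff_exists_fun _).mp (hdg v)
  have h1 : ι v = (laurentMap R d)⁻¹ • ι (d • v) := by
    rw [hι, inv_smul_smul₀ (laurentMap_ne_zero hd)]
  rw [h1, ← hf, map_sum_of_semilinear hι]
  exact Submodule.smul_mem _ _ (Submodule.sum_mem _ fun a _ =>
    Submodule.smul_mem _ _ (Submodule.subset_span ⟨a, rfl⟩))

/-- A connection over `R((x))` without `R`-torsion embeds into its base change to `K((x))`. -/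
theorem injective_of_noConstTorsion [IsNoetherianRing R] (hR : ∀ k : ℕ, k ≠ 0 → IsUnit (k : R))
    (hι : ∀ f w, ι (f • w) = laurentMap R f • ι w) (D : Connection R E)
    (D' : Connection (FractionRing R) V) (hDι : ∀ w, D'.nabla (ι w) = ι (D.nabla w))
    (hE : NoConstTorsion R E) {n : ℕ} {g : Fin n → E}
    (hG : LinearIndependent (FractionRing R)⸨X⸩ fun a => ι (g a))
    {d : R⸨X⸩} (hd : d ≠ 0) (hdg : ∀ v, d • v ∈ Submodule.span R⸨X⸩ (Set.range g))
    {w : E} (hw : ι w = 0) : w = 0 := by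
  -- The annihilator of `ker ι`. It contains `d` because the `ι (g a)` are independent, and is
  -- `ϑ`-stable by Leibniz because `ker ι` is `∇`-stable.
  let I : Ideal R⸨X⸩ :=
    { carrier := {f | ∀ v : E, ι v = 0 → f • v = 0}
      zero_mem' := fun v _ => zero_smul _ v
      add_mem' := fun {f f'} hf hf' v hv => by rw [add_smul, hf v hv, hf' v hv, add_zero]
      smul_mem' := fun c f hf v hv => by rw [smul_eq_mul, mul_smul, hf v hv, smul_zero] }
  have hdI : d ∈ I := by
    intro v hv
    obtain ⟨f, hf⟩ := (Submodule.mem_span_range_iff_exists_fun _).mp (hdg v)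
    have h1 : ∑ a, laurentMap R (f a) • ι (g a) = 0 := by
      rw [← map_sum_of_semilinear hι, hf, hι, hv, smul_zero]
    have h2 := Fintype.linearIndependent_iff.mp hG _ h1
    rw [← hf]
    refine Finset.sum_eq_zero fun a _ => ?_
    rw [laurentMap_injective ((h2 a).trans (map_zero _).symm), zero_smul]
  have hI : ∀ f ∈ I, euler R f ∈ I := by
    intro f hf v hv
    have h1 : ι (D.nabla v) = 0 := by
      rw [← hDι, hv, map_zero]
    have h2 := D.leibniz f v
    rwa [hf v hv, hf _ h1, map_zero, add_zero, eq_comm] at h2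
  obtain ⟨a, ha, haI⟩ := exists_C_mem_of_euler_stable hR I hI hdI hd
  exact hE a ha w (haI w hw)

/-- The descent from `K((x))` to `R((x))` of the splitting of a connection without turning
point. -/
theorem exists_basis_of_horizontal [IsDomain R] [IsPrincipalIdealRing R]
    (hR : ∀ k : ℤ, k ≠ 0 → IsUnit (k : R)) [Module.Finite R⸨X⸩ E]
    (hι : ∀ f w, ι (f • w) = laurentMap R f • ι w)
    (hspanι : Submodule.span (FractionRing R)⸨X⸩ (Set.range ι) = ⊤)
    (D : Connection R E) (D' : Connection (FractionRing R) V)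
    (hDι : ∀ w, D'.nabla (ι w) = ι (D.nabla w))
    (hE : NoConstTorsion R E) {n : ℕ} (hn : Module.finrank R⸨X⸩ E = n)
    {h : Fin n → R⸨X⸩} (hinv : ∀ i, h i ∈ invPoly R)
    (hu : ∀ i j, i ≠ j → ∀ m : ℤ, IsUnit (h i - h j + (m : R⸨X⸩)))
    {e : Fin n → V}
    (hli : LinearIndependent (FractionRing R)⸨X⸩ e)
    (hDe : ∀ i, D'.nabla (e i) = laurentMap R (h i) • e i) :
    ∃ u : Module.Basis (Fin n) R⸨X⸩ E, ∀ i, D.nabla (u i) = h i • u i := by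
  obtain ⟨g, -, d, hd, hdg⟩ := exists_linearIndependent_smul_mem_span hn
  have hspan := span_map_eq_top hι hspanι hd hdg
  have : Module.Finite (FractionRing R)⸨X⸩ V :=
    ⟨hspan ▸ Submodule.fg_span (Set.finite_range _)⟩
  -- `V` is spanned by the `n` vectors `ι (g a)` and contains the `n` independent vectors `e i`, so
  -- both families are bases.
  have hrank : Module.finrank (FractionRing R)⸨X⸩ V = n := by
    refine le_antisymm ?_ (by simpa using hli.fintype_card_le_finrank)
    have := finrank_range_le_card (R := (FractionRing R)⸨X⸩)
      (fun a => ι (g a))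
    rwa [Set.finrank, hspan, finrank_top, Fintype.card_fin] at this
  have hG := linearIndependent_of_top_le_span_of_card_eq_finrank hspan.ge
    (by rw [Fintype.card_fin, hrank])
  have hR' : ∀ k : ℕ, k ≠ 0 → IsUnit (k : R) := fun k hk => by
    simpa using hR k (by exact_mod_cast hk)
  set G := Module.Basis.mk hG hspan.ge with hGdef
  have hGa : ∀ a, G a = ι (g a) := fun a => Module.Basis.mk_apply _ _ a
  set b := Module.Basis.mk hli (hli.span_eq_top_of_card_eq_finrank'
    (by rw [Fintype.card_fin, hrank])).ge with hbdef
  have hbi : ∀ i, b i = e i := fun i => Module.Basis.mk_apply _ _ i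
  let T : E →ₗ[R⸨X⸩] (Fin n → (FractionRing R)⸨X⸩) :=
    { toFun := fun w => b.equivFun (ι w)
      map_add' := fun w w' => by rw [map_add, map_add]
      map_smul' := fun f w => by
        ext1 j
        rw [hι, map_smul, Pi.smul_apply, RingHom.id_apply, Pi.smul_apply,
          smul_eq_laurentMap_mul, smul_eq_mul] }
  have hT : ∀ w, T w = b.equivFun (ι w) := fun w => rfl
  -- coordinates with respect to `G` of the image of `w`
  have hcoord : ∀ (w : E) (f : Fin n → R⸨X⸩), ∑ a, f a • g a = d • w → ∀ a,
      laurentMap R d * G.repr (ι w) a = laurentMap R (f a) := by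
    intro w f hf a
    have h1 : laurentMap R d • ι w
        = ∑ a, laurentMap R (f a) • G a := by
      rw [← hι, ← hf, map_sum_of_semilinear hι]
      simp only [hGa]
    have h2 := congrArg (fun z => G.repr z a) h1
    simpa only [map_smul, Finsupp.smul_apply, smul_eq_mul, G.repr_sum_self] using h2
  have hex : ∀ w, ∃ f : Fin n → R⸨X⸩, ∑ a, f a • g a = d • w := fun w =>
    (Submodule.mem_span_range_iff_exists_fun _).mp (hdg w)
  refine exists_basis_of_embedding hR D hinv hu T ?_ ?_ ?_ ?_ ?_
  · rw [injective_iff_map_eq_zero]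
    intro w hw
    rw [hT, LinearEquiv.map_eq_zero_iff] at hw
    exact injective_of_noConstTorsion hR' hι D D' hDι hE hG hd hdg hw
  · intro v hv
    -- `N` and `M` bound the poles of the change of basis and of `d`: approximation of `v` to order
    -- `k + N + M` becomes approximation to order `k` of `d` times the `G`-coordinates.
    obtain ⟨N, hN⟩ := exists_nat_forall_mem_ordGE fun p : Fin n × Fin n => G.repr (b p.1) p.2
    obtain ⟨M, hM⟩ := exists_nat_forall_mem_ordGE fun _ : Unit => d
    specialize hM ()
    -- approximation in the coordinates of `G`
    have hrepr : ∀ (v : Fin n → (FractionRing R)⸨X⸩) a,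
        G.repr (b.equivFun.symm v) a = ∑ j, v j * G.repr (b j) a := by
      intro v a
      rw [b.equivFun_symm_apply, map_sum, Finsupp.finsetSum_apply]
      simp only [map_smul, Finsupp.smul_apply, smul_eq_mul]
    have happ : ∀ k : ℕ, ∃ w, ∃ f : Fin n → R⸨X⸩, ∑ a, f a • g a = d • w ∧
        ∀ a, laurentMap R d * G.repr (b.equivFun.symm v) a - laurentMap R (f a)
          ∈ ordGE (FractionRing R) k := by
      intro k
      obtain ⟨_, ⟨w, rfl⟩, hw⟩ := hv (k + N + M)
      obtain ⟨f, hf⟩ := hex w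
      refine ⟨w, f, hf, fun a => ?_⟩
      have h1 : ι w = b.equivFun.symm (T w) := by
        rw [hT, LinearEquiv.symm_apply_apply]
      rw [← hcoord w f hf a, h1, hrepr, hrepr, ← mul_sub, ← Finset.sum_sub_distrib]
      have h2 : ∑ j, (v j * G.repr (b j) a - T w j * G.repr (b j) a)
          ∈ ordGE (FractionRing R) (k + M) := by
        refine sum_mem fun j _ => ?_
        rw [← sub_mul]
        exact ordGE_anti (by push_cast; omega) (mul_mem_ordGE (hw j) (hN (j, a)))
      exact ordGE_anti (by omega) (mul_mem_ordGE (laurentMap_mem_ordGE hM) h2)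
    -- Each coefficient of the limit agrees with that of a good enough approximant, hence lies in
    -- `R`.
    have hy : ∀ a, ∃ y : R⸨X⸩, laurentMap R y = laurentMap R d * G.repr (b.equivFun.symm v) a := by
      refine fun a => exists_laurentMap_eq fun l => ?_
      obtain ⟨w, f, -, hf⟩ := happ (l.toNat + 1)
      refine ⟨(f a).coeff l, ?_⟩
      have := hf a l (by have := Int.self_le_toNat l; push_cast; omega)
      rw [HahnSeries.coeff_sub, sub_eq_zero] at this
      rw [this, laurentMap_coeff]
    choose y hy using hy
    -- The coefficient vectors of elements of `d E`, closed as a submodule of `R((x))ⁿ`; it contains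
    -- the limit `y`.
    let U : Submodule R⸨X⸩ (Fin n → R⸨X⸩) :=
      (LinearMap.range (LinearMap.lsmul R⸨X⸩ E d)).comap (Fintype.linearCombination R⸨X⸩ g)
    have hyU : y ∈ U := by
      refine mem_of_forall_exists_sub_mem_ordGE U y fun k => ?_
      obtain ⟨w, f, hf, hfk⟩ := happ k
      refine ⟨f, ⟨w, hf.symm⟩, fun a => mem_ordGE_of_laurentMap ?_⟩
      rw [map_sub, hy]
      exact hfk a
    obtain ⟨w, hw⟩ := hyU
    have hw' : ∑ a, y a • g a = d • w := hw.symm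
    refine ⟨w, ?_⟩
    rw [hT, ← LinearEquiv.eq_symm_apply]
    refine G.ext_elem fun a => mul_left_cancel₀ (laurentMap_ne_zero hd) ?_
    rw [hcoord w y hw', hy]
  · intro w j
    have h1 : D'.nabla (ι w) = ∑ j, (euler (FractionRing R) (T w j)
        + laurentMap R (h j) * T w j) • b j := by
      have h2 : ι w = ∑ j, T w j • b j := by
        rw [hT, b.sum_equivFun]
      rw [h2, map_sum]
      refine Finset.sum_congr rfl fun j _ => ?_
      rw [D'.leibniz, hbi, hDe, smul_smul, ← add_smul, mul_comm (T w j)]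
    rw [hDι] at h1
    rw [hT, h1, b.equivFun_apply, b.repr_sum_self]
  · intro i
    have h1 : ∃ a, G.repr (b i) a ≠ 0 := by
      by_contra! hz
      exact b.ne_zero i (G.repr.map_eq_zero_iff.mp (Finsupp.ext hz))
    obtain ⟨a, ha⟩ := h1
    -- If `w` maps to `s • b i`, then `s c` is a coordinate of `d w`, hence has coefficients in `R`.
    -- So the lowest coefficient of `c` bounds the denominator of `s`.
    set c := laurentMap R d * G.repr (b i) a with hc
    have hc0 : c ≠ 0 := mul_ne_zero (laurentMap_ne_zero hd) ha
    refine ⟨c.coeff c.order, HahnSeries.coeff_order_eq_zero.not.mpr hc0, fun w s hw => ?_⟩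
    obtain ⟨f, hf⟩ := hex w
    have h2 : ι w = (HahnSeries.C s : (FractionRing R)⸨X⸩) • b i := by
      rw [hT, ← LinearEquiv.eq_symm_apply, b.equivFun_symm_apply] at hw
      rw [hw, Finset.sum_eq_single i (fun j _ hj => by
          rw [Pi.single_eq_of_ne hj]
          exact zero_smul (FractionRing R)⸨X⸩ (b j))
        (fun hi => absurd (Finset.mem_univ i) hi), Pi.single_eq_same]
    have h3 := hcoord w f hf a
    rw [h2, map_smul, Finsupp.smul_apply, smul_eq_mul, mul_left_comm, ← hc] at h3
    refine ⟨(f a).coeff c.order, ?_⟩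
    rw [← laurentMap_coeff, ← h3, coeff_C_mul']
  · intro i
    by_contra! hz
    have h1 : b.coord i = 0 := by
      refine G.ext fun a => ?_
      have := hz (g a)
      rw [hT, ← hGa] at this
      exact this
    have h2 := LinearMap.congr_fun h1 (b i)
    rw [b.coord_apply, b.repr_self, Finsupp.single_eq_same] at h2
    exact one_ne_zero h2

end Embedding

/-! ### The map from `E` to its base change -/

section BaseChange
variable {R : Type*} [CommRing R] {E : Type*} [AddCommGroup E] [Module R⸨X⸩ E]

theorem baseChange_nabla_one_tmul (D : Connection R E) (w : E) :
    D.baseChange.nabla ((1 : (FractionRing R)⸨X⸩) ⊗ₜ[R⸨X⸩] w) = 1 ⊗ₜ[R⸨X⸩] D.nabla w := by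
  have : euler (FractionRing R) 1 = 0 := euler_C 1
  rw [Connection.baseChange_tmul, this, TensorProduct.zero_tmul, zero_add]

theorem one_tmul_smul (f : R⸨X⸩) (w : E) :
    (1 : (FractionRing R)⸨X⸩) ⊗ₜ[R⸨X⸩] (f • w) = laurentMap R f • (1 ⊗ₜ[R⸨X⸩] w) := by
  rw [← TensorProduct.smul_tmul, TensorProduct.smul_tmul', smul_eq_laurentMap_mul, smul_eq_mul]

theorem span_one_tmul_eq_top : Submodule.span (FractionRing R)⸨X⸩
    (Set.range fun w : E => (1 : (FractionRing R)⸨X⸩) ⊗ₜ[R⸨X⸩] w) = ⊤ := by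
  rw [eq_top_iff]
  intro z _
  induction z using TensorProduct.induction_on with
  | zero => exact zero_mem _
  | add y z hy hz => exact add_mem (hy trivial) (hz trivial)
  | tmul c v =>
    have h1 : c ⊗ₜ[R⸨X⸩] v = c • ((1 : (FractionRing R)⸨X⸩) ⊗ₜ[R⸨X⸩] v) := by
      rw [TensorProduct.smul_tmul', smul_eq_mul, mul_one]
    rw [h1]
    exact Submodule.smul_mem _ _ (Submodule.subset_span ⟨v, rfl⟩)

/-- The natural map from `E` to its base change to `K((x))`. -/
def toBaseChange : E →+ (FractionRing R)⸨X⸩ ⊗[R⸨X⸩] E :=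
  (TensorProduct.mk R⸨X⸩ (FractionRing R)⸨X⸩ E 1).toAddMonoidHom

end BaseChange

/-! ### From a diagonal basis to the TLJ-form -/

section Form
variable {A : Type*} [CommRing A] {E : Type*} [AddCommGroup E] [Module A⸨X⸩ E]

theorem shift_iterate_sum (D : Connection A E) {n : ℕ} {u : Fin n → E}
    {f : Fin n → A⸨X⸩} (hu : ∀ i, D.nabla (u i) = f i • u i) (g : A⸨X⸩) (q : ℕ)
    (c : Fin n → A⸨X⸩) : (D.shift g)^[q] (∑ i, c i • u i)
      = ∑ i, (fun s => euler A s + (f i - g) * s)^[q] (c i) • u i := by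
  induction q generalizing c with
  | zero => rfl
  | succ q ih =>
    have h1 : D.shift g (∑ i, c i • u i) = ∑ i, (euler A (c i) + (f i - g) * c i) • u i := by
      rw [Connection.shift, map_sum, Finset.smul_sum, ← Finset.sum_sub_distrib]
      refine Finset.sum_congr rfl fun i _ => ?_
      rw [D.leibniz, hu, smul_smul, smul_smul, ← add_smul, ← sub_smul]
      congr 1
      ring
    rw [Function.iterate_succ_apply, h1, ih]
    rfl

/-- A connection with a basis of horizontal vectors for distinct characters admits a TLJ-form. -/
theorem admitsTLJForm_of_basis [IsDomain A] (D : Connection A E) {n : ℕ} (u : Module.Basis (Fin n) A⸨X⸩ E)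
    (f : Fin n → invPoly A) (hu : ∀ i, D.nabla (u i) = (f i : A⸨X⸩) • u i)
    (hf : Function.Injective fun i => charClass (f i)) : D.AdmitsTLJForm := by
  classical
  set φ : Fin n → CharGroup A := fun i => charClass (f i) with hφ
  have hrep : ∀ i, Represents (f i : A⸨X⸩) (φ i) := fun i =>
    ⟨f i, rfl, by rw [sub_self]; exact zero_mem _⟩
  let σ : Fin n ≃ Set.range φ := Equiv.ofInjective φ hf
  -- The supremum over the fibre of `φ` is one line on the range of `φ` and zero elsewhere.
  let F : CharGroup A → Submodule A⸨X⸩ E := fun ψ =>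
    ⨆ i : {i : Fin n // φ i = ψ}, Submodule.span A⸨X⸩ {u i}
  have hF : ∀ i, F (φ i) = Submodule.span A⸨X⸩ {u i} := fun i => by
    refine le_antisymm (iSup_le ?_) (le_iSup_of_le ⟨i, rfl⟩ le_rfl)
    rintro ⟨j, hj⟩
    exact (congrArg (fun k => Submodule.span A⸨X⸩ {u k}) (hf hj)).le
  have hind : iSupIndep fun i => Submodule.span A⸨X⸩ {u i} :=
    u.linearIndependent.iSupIndep_span_singleton
  have hker : ∀ i, ∀ q ≥ 1, F (φ i) = D.kerSpan (f i : A⸨X⸩) q := by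
    intro i q hq
    rw [hF, Connection.kerSpan]
    refine le_antisymm (Submodule.span_mono ?_) (Submodule.span_le.mpr ?_)
    · rintro _ rfl
      obtain ⟨q, rfl⟩ := Nat.exists_eq_add_of_le' hq
      have h0 : D.shift (f i : A⸨X⸩) 0 = 0 := by simp [Connection.shift]
      have h1 : D.shift (f i : A⸨X⸩) (u i) = 0 := by rw [Connection.shift, hu, sub_self]
      change (D.shift (f i : A⸨X⸩))^[q + 1] (u i) = 0
      rw [Function.iterate_succ_apply, h1]
      exact Function.iterate_fixed h0 q
    · intro v hv
      have h1 : (D.shift (f i : A⸨X⸩))^[q] v = 0 := hv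
      rw [← u.sum_repr v, shift_iterate_sum D hu] at h1
      have h2 := Fintype.linearIndependent_iff.mp u.linearIndependent _ h1
      have h3 : ∀ j, j ≠ i → u.repr v j = 0 := by
        intro j hj
        -- A kernel element of `ϑ + f j - f i` would make `f i - f j` a logarithmic derivative,
        -- hence an integer. So only the `i`-th component survives in `ker (∇ - f i)^q`.
        have hinj : ∀ s : A⸨X⸩, s ≠ 0 → euler A s + ((f j : A⸨X⸩) - f i) * s ≠ 0 := by
          intro s hs h0
          refine hj (hf (charClass_eq_of_sub_mem_intConst ?_))
          have := mem_intConst_of_euler_eq_mul (g := -((f j : A⸨X⸩) - (f i : A⸨X⸩)))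
            (neg_mem (sub_mem (f j).2 (f i).2)) hs (by linear_combination h0)
          simpa using neg_mem this
        have hit : ∀ (q : ℕ) (s : A⸨X⸩), s ≠ 0 →
            (fun s => euler A s + ((f j : A⸨X⸩) - f i) * s)^[q] s ≠ 0 := by
          intro q
          induction q with
          | zero => exact fun s hs => hs
          | succ q ih => exact fun s hs => ih _ (hinj s hs)
        by_contra hne
        exact hit q _ hne (h2 j)
      rw [SetLike.mem_coe, ← u.sum_repr v, Finset.sum_eq_single i
        (fun j _ hj => by rw [h3 j hj, zero_smul]) (fun hi => absurd (Finset.mem_univ i) hi)]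
      exact Submodule.smul_mem _ _ (Submodule.mem_span_singleton_self _)
  have hFσ : (fun ψ : Set.range φ => F ψ) ∘ σ = fun i => Submodule.span A⸨X⸩ {u i} :=
    funext fun i => hF i
  refine ⟨Set.range φ, F, ⟨Set.finite_range φ, ?_, ?_, ?_, ?_, ?_⟩, ?_⟩
  · rw [← hFσ] at hind
    have := hind.comp σ.symm.injective
    rwa [Function.comp_assoc, σ.self_comp_symm, Function.comp_id] at this
  · rw [← σ.iSup_comp (g := fun ψ : Set.range φ => F ψ)]
    rw [eq_top_iff, ← u.span_eq, Submodule.span_le]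
    rintro _ ⟨i, rfl⟩
    refine Submodule.mem_iSup_of_mem i ?_
    change u i ∈ F (φ i)
    rw [hF]
    exact Submodule.mem_span_singleton_self _
  · rintro _ ⟨i, rfl⟩
    rw [hF, Ne, Submodule.span_singleton_eq_bot]
    exact u.ne_zero i
  · rintro _ ⟨i, rfl⟩ v hv
    rw [hF, Submodule.mem_span_singleton] at hv ⊢
    obtain ⟨c, rfl⟩ := hv
    exact ⟨euler A c + c * f i, by rw [D.leibniz, hu, smul_smul, ← add_smul]⟩
  · rintro _ ⟨i, rfl⟩
    exact ⟨f i, hrep i, 1, hker i⟩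
  · rintro _ ⟨i, rfl⟩
    refine ⟨f i, hrep i, 1, ?_⟩
    have hli : LinearIndependent A⸨X⸩ fun _ : Fin 1 => u i :=
      u.linearIndependent.comp (fun _ => i) (Function.injective_of_subsingleton _)
    have hFi : Submodule.span A⸨X⸩ (Set.range fun _ : Fin 1 => u i) = F (φ i) := by
      rw [hF, Set.range_const]
    refine ⟨(Module.Basis.span hli).map (LinearEquiv.ofEq _ _ hFi), fun _ _ => f i, ?_, ?_⟩
    · intro k l
      have := Subsingleton.elim k l
      exact ⟨fun _ => rfl, fun h => by omega, fun h => absurd this h⟩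
    · intro k
      have hk : ∀ k, (((Module.Basis.span hli).map (LinearEquiv.ofEq _ _ hFi) k : F (φ i)) : E)
          = u i := fun k => by
        rw [Module.Basis.map_apply, LinearEquiv.coe_ofEq_apply, Module.Basis.span_apply]
      rw [Fin.sum_univ_one, hk, hk, hu]

/-- Representatives in `A[x⁻¹]` of the same characters give equivalent diagonal forms. -/
theorem exists_basis_of_charClass_eq (D : Connection A E) {n : ℕ}
    (u : Module.Basis (Fin n) A⸨X⸩ E) (h f : Fin n → invPoly A)
    (hu : ∀ i, D.nabla (u i) = (h i : A⸨X⸩) • u i) (hf : ∀ i, charClass (f i) = charClass (h i)) :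
    ∃ e : Module.Basis (Fin n) A⸨X⸩ E, ∀ i, D.nabla (e i) = (f i : A⸨X⸩) • e i := by
  choose m hm using fun i => sub_mem_intConst_of_charClass_eq (hf i)
  -- Scaling by `x ^ m` adds the integer `m` to the eigenvalue.
  refine ⟨u.isUnitSMul fun i => isUnit_single (A := A) (m i), fun i => ?_⟩
  have hm' : ((m i : ℤ) : A⸨X⸩) = f i - h i := hm i
  rw [Module.Basis.isUnitSMul_apply, D.leibniz, euler_single, hu, smul_smul, smul_smul, ← add_smul,
    hm']
  congr 1
  ring

end Form

theorem charMap_charClass {R : Type*} [CommRing R] (h : invPoly R) :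
    ∃ g : invPoly (FractionRing R), (g : (FractionRing R)⸨X⸩) = laurentMap R h ∧
      charMap (charClass h) = charClass g :=
  ⟨⟨laurentMap R h, fun k hk => by rw [laurentMap_coeff, h.2 k hk, map_zero]⟩, rfl, rfl⟩

end RelConn
end

/-! ### The main theorem -/

open RelConn in
theorem mainTheorem9 {C R E : Type*} [Field C] [IsAlgClosed C] [CharZero C]
    [CommRing R] [IsDomain R] [IsDiscreteValuationRing R]
    [IsAdicComplete (IsLocalRing.maximalIdeal R) R] [Algebra C R]
    (hR : Nonempty (R ≃ₐ[C] C⟦X⟧))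
    [AddCommGroup E] [Module R⸨X⸩ E] [Module.Finite R⸨X⸩ E]
    (hE : NoConstTorsion R E) (D : Connection R E)
    (n : ℕ) (hn : Module.finrank R⸨X⸩ E = n)
    (φ : Fin n → CharGroup R) (hφ : Function.Injective φ)
    (hchar : ∀ i, D.HasCharacter (φ i))
    (hturn : NoTurningPoint φ) :
    D.AdmitsTLJForm ∧
    ∀ f : Fin n → invPoly R, (∀ i, charClass (f i) = φ i) →
      ∃ e : Module.Basis (Fin n) R⸨X⸩ E, ∀ i, D.nabla (e i) = (f i : R⸨X⸩) • e i := by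
  obtain ⟨h, hh, -, hu⟩ := hturn
  have hunit : ∀ k : ℤ, k ≠ 0 → IsUnit (k : R) := fun k hk => by
    have := (IsUnit.mk0 (k : C) (by exact_mod_cast hk)).map (algebraMap C R)
    rwa [map_intCast] at this
  have : CharZero R := charZero_of_injective_algebraMap (algebraMap C R).injective
  have : CharZero (FractionRing R) :=
    charZero_of_injective_algebraMap (IsFractionRing.injective R (FractionRing R))
  have heig : ∀ i, ∃ e, e ≠ 0 ∧ D.baseChange.nabla e = laurentMap R (h i) • e := by
    intro i
    obtain ⟨Φ, F, hT, hi⟩ := hchar i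
    obtain ⟨g, hg, hg'⟩ := charMap_charClass (h i)
    rw [← hh i, hg'] at hi
    rw [← hg]
    exact exists_nabla_eq_smul_of_mem hT hi
  choose e he0 he using heig
  have hli : LinearIndependent (FractionRing R)⸨X⸩ e := by
    refine linearIndependent_of_nabla_eq_smul D.baseChange he0 he (fun i j _ => ?_) ?_
    · rw [← map_sub]
      exact fun k hk => by
        rw [laurentMap_coeff, sub_mem (h i).2 (h j).2 k hk, map_zero]
    -- If `h i - h j` were the integer `m`, its shift by `-m` would be a unit equal to zero.
    · rintro i j hij ⟨m, hm⟩
      have hm' : ((m : ℤ) : (FractionRing R)⸨X⸩) = laurentMap R (h i) - laurentMap R (h j) := hm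
      rw [← map_sub, ← map_intCast (laurentMap R)] at hm'
      have h1 := hu i j hij (-m)
      rw [← laurentMap_injective hm', Int.cast_neg, add_neg_cancel] at h1
      exact not_isUnit_zero h1
  obtain ⟨u, hDu⟩ := exists_basis_of_horizontal hunit (ι := toBaseChange) one_tmul_smul
    span_one_tmul_eq_top D D.baseChange (baseChange_nabla_one_tmul D) hE hn (fun i => (h i).2) hu hli he
  refine ⟨admitsTLJForm_of_basis D u h hDu fun i j hij => hφ ?_, fun f hf =>
    exists_basis_of_charClass_eq D u h f hDu fun i => (hf i).trans (hh i).symm⟩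
  rw [← hh i, ← hh j]
  exact hij
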